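/- **Theorem (Gradient consistency).** Let $\mathcal H$ be a finite-dimensional real Hilbert space, $\mathcal Y$ a real Banach space, $\mathcal K\subset\mathcal Y$ a nonempty closed convex cone with positive polar cone $\mathcal K^+=\{v^*\in\mathcal Y^*:\langle v^*,y\rangle\ge 0\ \forall y\in\mathcal K\}$, and let $\mathcal C\subset\mathcal Y^*$ be a nonempty weak$^*$-compact convex set with $\operatorname{cl}^{w^*}\operatorname{cone}\mathcal C=\mathcal K^+$. Let $m\ge 1$, let $\Phi:\mathcal H\times\mathbb R^m\to\mathcal Y$, and let $h:\mathcal H\to\mathbb R$ be convex and continuously differentiable, such that for every $v^*\in\mathcal C$ the function $(x,z)\mapsto\langle v^*,\Phi(x,z)\rangle+h(x)$ is convex on $\mathcal H\times\mathbb R^m$. Put $$S^h_\Phi(x,z)=\sup_{v^*\in\mathcal C}\{\langle v^*,\Phi(x,z)\rangle+h(x)\},\qquad S_\lambda(x,z)=\inf_{(x',z')}\Big\{S^h_\Phi(x',z')+\tfrac1{2\lambda}\big(\|x-x'\|^2+\|z-z'\|^2\big)\Big\}\quad(\lambda>0).$$ Let $\xi$ be a random vector in $\mathbb R^m$ with a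 continuous density $f_\xi$ satisfying $\lim_{\|z\|\to\infty}\|z\|^{m+1}f_\xi(z)=0$, and set $$\varphi(x)=\mathbb P(\Phi(x,\xi)\in-\mathcal K),\qquad \varphi_\lambda(x)=\mathbb P(S_\lambda(x,\xi)\le h(x)).$$ Let $L\in\mathbb R^{m\times m}$ be nonsingular, $\theta(r,v)=\frac{2\pi^{m/2}|\det L|}{\Gamma(m/2)}r^{m-1}f_\xi(rLv)$, and let $\bar x\in\mathcal H$ satisfy $S^h_\Phi(\bar x,0)<h(\bar x)$. Let $F(\bar x)=\{v\in\mathbb S^{m-1}:\exists r>0,\ S^h_\Phi(\bar x,rLv)=h(\bar x)\}$ be the set of finite directions, $I(\bar x)=\mathbb S^{m-1}\setminus F(\bar x)$, and $\rho(\bar x,v)=\sup\{r>0: S^h_\Phi(\bar x,rLv)\le h(\bar x)\}$. Assume: 1. ($\eta_\theta$-growth condition) for every $\bar v\in I(\bar x)$ there are $\eta_\theta:\mathbb R\times\mathbb S^{m-1}\to[0,\infty]$ with $r\,\theta(r,v)\,\eta_\theta(r,v)\to0$ as $r\to\infty$, $v\to\bar v$ (with the convention $0\cdot\infty=0$), and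 $\epsilon,l>0$ such that every element $x^*$ of the partial convex subdifferential $\partial_xS^h_\Phi(x,rLv)$ satisfies $\|x^*\|\le l\,\eta_\theta(r,v)$, for all $x\in\mathbb B_\epsilon(\bar x)$, $v\in\mathbb S^{m-1}\cap\mathbb B_\epsilon(\bar v)$ and $r\ge l$; 2. for almost every $v\in\mathbb S^{m-1}$ (with respect to surface measure), if $v\in F(\bar x)$, then the convex subdifferential $\partial S^h_\Phi(\bar x,\rho(\bar x,v)Lv)$ is a singleton. Then $\varphi$ is Lipschitz on a neighbourhood of $\bar x$ and Fréchet differentiable at $\bar x$. Moreover, for all sequences $\lambda_k\to0$ with $\lambda_k>0$ and $x_k\to\bar x$, the function $\varphi_{\lambda_k}$ is differentiable at $x_k$ for all large $k$, and every accumulation point of $(\nabla\varphi_{\lambda_k}(x_k))_k$ equals $\nabla\varphi(\bar x)$. -/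

import Mathlib

open Set Filter Topology MeasureTheory
open scoped ENNReal NNReal

namespace ConicChance

noncomputable section

/-- The random space `ℝ^m`, with its Euclidean norm. -/
abbrev Rm (m : ℕ) : Type := EuclideanSpace ℝ (Fin m)

/-- The unit sphere `𝕊^{m-1}` of `ℝ^m`. -/
abbrev Sph (m : ℕ) : Type := Metric.sphere (0 : Rm m) 1

/-- The convex subdifferential of a real-valued function on a Hilbert space. -/
def subdiff {E : Type*} [NormedAddCommGroup E] [InnerProductSpace ℝ E]
    (ψ : E → ℝ) (x : E) : Set E :=
  {s | ∀ y, ψ x + inner ℝ s (y - x) ≤ ψ y}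

/-- The Moreau envelope of parameter `lam`. For `lam > 0` and `ψ` convex and continuous the family
under the infimum is bounded below, so that the infimum is the genuine one. -/
def moreau {E : Type*} [NormedAddCommGroup E] (ψ : E → ℝ) (lam : ℝ) (x : E) : ℝ :=
  ⨅ z : E, (ψ z + 1 / (2 * lam) * ‖x - z‖ ^ 2)

variable {H : Type*} [NormedAddCommGroup H] [InnerProductSpace ℝ H]
variable {Y : Type*} [NormedAddCommGroup Y] [NormedSpace ℝ Y]
variable {m : ℕ}

/-- `C` generates the positive polar cone of `K`: the weak-star closure of
`cone C = {t w : t ≥ 0, w ∈ C}` is `K⁺ = {w : ⟨w, y⟩ ≥ 0 for all y ∈ K}`. -/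
def GeneratesPolar (C : Set (WeakDual ℝ Y)) (K : ProperCone ℝ Y) : Prop :=
  closure {w : WeakDual ℝ Y | ∃ t : ℝ, 0 ≤ t ∧ ∃ c ∈ C, w = t • c}
    = {w : WeakDual ℝ Y | ∀ y ∈ K, 0 ≤ w y}

/-- The supremum function `S(x,z) = sup {⟨w, Φ(x,z)⟩ + h(x) : w ∈ C}` on the Hilbert product
`H × ℝ^m` (with norm `‖(x,z)‖² = ‖x‖² + ‖z‖²`). -/
def supFun (C : Set (WeakDual ℝ Y)) (Φ : H → Rm m → Y) (h : H → ℝ)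
    (p : WithLp 2 (H × Rm m)) : ℝ :=
  sSup ((fun w : WeakDual ℝ Y => w (Φ p.fst p.snd) + h p.fst) '' C)

/-- The point `(x, z)` of the Hilbert product `H × ℝ^m`. -/
def pt (x : H) (z : Rm m) : WithLp 2 (H × Rm m) := WithLp.toLp 2 (x, z)

/-- The probability function `φ(x) = ℙ(Φ(x,ξ) ∈ -K)`. -/
def prob {Ω : Type*} [MeasurableSpace Ω] (P : Measure Ω) (ξ : Ω → Rm m)
    (Φ : H → Rm m → Y) (K : ProperCone ℝ Y) (x : H) : ℝ :=
  P.real {ω | -(Φ x (ξ ω)) ∈ K}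

/-- The inner regularization `φ_lam(x) = ℙ(S_lam(x,ξ) ≤ h(x))`, where `S_lam` is the Moreau
envelope of `S` in both variables. -/
def probReg {Ω : Type*} [MeasurableSpace Ω] (P : Measure Ω) (ξ : Ω → Rm m)
    (S : WithLp 2 (H × Rm m) → ℝ) (h : H → ℝ) (lam : ℝ) (x : H) : ℝ :=
  P.real {ω | moreau S lam (pt x (ξ ω)) ≤ h x}

/-- The point `r L v` of `ℝ^m`. -/
def ray (L : Matrix (Fin m) (Fin m) ℝ) (r : ℝ) (v : Sph m) : Rm m :=
  r • Matrix.toEuclideanLin L (v : Rm m)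

/-- The density-like function
`θ(r,v) = (2 π^{m/2} |det L| / Γ(m/2)) r^{m-1} f(r L v)`. -/
def theta (L : Matrix (Fin m) (Fin m) ℝ) (f : Rm m → ℝ) (r : ℝ) (v : Sph m) : ℝ :=
  2 * Real.pi ^ ((m : ℝ) / 2) * |L.det| / Real.Gamma ((m : ℝ) / 2)
    * r ^ (m - 1) * f (ray L r v)

/-- The finite directions at `x`. -/
def finDir (S : WithLp 2 (H × Rm m) → ℝ) (h : H → ℝ) (L : Matrix (Fin m) (Fin m) ℝ)
    (x : H) : Set (Sph m) :=
  {v | ∃ r : ℝ, 0 < r ∧ S (pt x (ray L r v)) = h x}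

/-- The infinite directions at `x`. -/
def infDir (S : WithLp 2 (H × Rm m) → ℝ) (h : H → ℝ) (L : Matrix (Fin m) (Fin m) ℝ)
    (x : H) : Set (Sph m) :=
  (finDir S h L x)ᶜ

/-- The radial function `ρ(x,v) = sup {r > 0 : S(x, r L v) ≤ h(x)}`. It is only used for finite
directions `v`, where (if `S(x,0) < h(x)` and `S` is convex) the supremum is finite. -/
def rho (S : WithLp 2 (H × Rm m) → ℝ) (h : H → ℝ) (L : Matrix (Fin m) (Fin m) ℝ)
    (x : H) (v : Sph m) : ℝ :=
  sSup {r : ℝ | 0 < r ∧ S (pt x (ray L r v)) ≤ h x}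

/-- The `η_θ`-growth condition of `S` at `(x₀, v₀)`: there is `η : ℝ × 𝕊^{m-1} → [0,∞]` with
`r θ(r,v) η(r,v) → 0` as `r → ∞`, `v → v₀`, and there are `ε, l > 0` such that every element of
the partial subdifferential of `S` with respect to `x` at `(x, r L v)` has norm at most `l η(r,v)`,
for all `x ∈ 𝔹_ε(x₀)`, `v ∈ 𝔹_ε(v₀)` and `r ≥ l`. -/
def EtaGrowth (S : WithLp 2 (H × Rm m) → ℝ) (L : Matrix (Fin m) (Fin m) ℝ) (f : Rm m → ℝ)
    (x₀ : H) (v₀ : Sph m) : Prop :=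
  ∃ η : ℝ → Sph m → ℝ≥0∞,
    Tendsto (fun q : ℝ × Sph m => ENNReal.ofReal (q.1 * theta L f q.1 q.2) * η q.1 q.2)
      (atTop ×ˢ 𝓝 v₀) (𝓝 0) ∧
    ∃ ε l : ℝ, 0 < ε ∧ 0 < l ∧
      ∀ x ∈ Metric.closedBall x₀ ε, ∀ v ∈ Metric.closedBall v₀ ε, ∀ r : ℝ, l ≤ r →
        ∀ s ∈ subdiff (fun x' => S (pt x' (ray L r v))) x,
          ENNReal.ofReal ‖s‖ ≤ ENNReal.ofReal l * η r v

end

end ConicChance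

/-!
Everything happens in the variable `u = 1 / r` along the rays from the origin. By the Slater
condition and convexity, the reciprocal `τ(x, v)` of the radial function is Lipschitz in `x` near
`x₀`, uniformly in the direction `v` and in the convex minorants of `S`; unbounded directions, where
`τ = 0`, play no special role. The tail condition says precisely that the density `u⁻¹ ^ (m + 1) *
f (u⁻¹ • L v)` of `f` on the ray extends continuously by `0` to `u = 0`, so that the mass of the
feasible part of the ray is a `C¹` function of `τ` whose derivative vanishes at `τ = 0`. Hence this
mass is Lipschitz in `x`; it is differentiable if `τ(x₀, v) = 0`, and otherwise by the implicit
function theorem, since `S` is differentiable where its subdifferential is a singleton. Integrating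
over the sphere by dominated convergence gives the assertions on `φ`. The Moreau envelopes are
differentiable convex minorants of `S` whose gradients converge to subgradients of `S`, hence the
same argument gives the differentiability of `φ_λ`, and dominated convergence the limit of its
gradients.
-/

namespace ConicChance

section ConvexAnalysis

theorem exists_clm_add_le_of_convexOn {E : Type*} [AddCommGroup E] [Module ℝ E]
    [TopologicalSpace E] [IsTopologicalAddGroup E] [ContinuousSMul ℝ E] {ψ : E → ℝ}
    (hψ : ConvexOn ℝ univ ψ) (hcont : Continuous ψ) (x : E) :
    ∃ g : E →L[ℝ] ℝ, ∀ y, ψ x + g (y - x) ≤ ψ y := by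
  have hopen : IsOpen {p : E × ℝ | p.1 ∈ (univ : Set E) ∧ ψ p.1 < p.2} := by
    simpa using isOpen_lt (hcont.comp continuous_fst) continuous_snd
  obtain ⟨l, hl⟩ := geometric_hahn_banach_open_point hψ.convex_strict_epigraph hopen
    (x := (x, ψ x)) (by simp)
  have hl_split (y : E) (t : ℝ) : l (y, t) = l (y, 0) + t * l (0, 1) := by
    rw [← smul_eq_mul, ← map_smul, ← map_add]
    simp
  have hslope : l (0, 1) < 0 := by
    have := hl (x, ψ x + 1) (by simp)
    rw [hl_split, hl_split x (ψ x)] at this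
    linarith
  set b := -l (0, 1) with hb
  have hb_pos : 0 < b := by linarith
  have hle (y : E) : l (y - x, 0) ≤ b * (ψ y - ψ x) := by
    refine le_of_forall_pos_lt_add fun ε hε => ?_
    have hsep := hl (y, ψ y + ε / b) (by simp [hε, hb_pos])
    have hsub : l (y - x, 0) = l (y, 0) - l (x, 0) := by simp [← map_sub]
    have hε_eq : ε / b * l (0, 1) = -ε := by rw [show l (0, 1) = -b by simp [hb]]; field_simp
    rw [hl_split, hl_split x (ψ x), add_mul, hε_eq] at hsep
    rw [hsub, hb]
    linarith
  refine ⟨b⁻¹ • l.comp (ContinuousLinearMap.inl ℝ E ℝ), fun y => ?_⟩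
  have := mul_le_mul_of_nonneg_left (hle y) (inv_nonneg.2 hb_pos.le)
  rw [inv_mul_cancel_left₀ hb_pos.ne'] at this
  simp only [smul_apply, ContinuousLinearMap.comp_apply,
    ContinuousLinearMap.inl_apply, smul_eq_mul]
  linarith

theorem hasFDerivAt_of_convexOn_of_le_quadratic {E : Type*} [NormedAddCommGroup E]
    [NormedSpace ℝ E] {g : E → ℝ} (hg : ConvexOn ℝ univ g) {x : E} {g' : E →L[ℝ] ℝ} {c : ℝ}
    (hle : ∀ d, g (x + d) ≤ g x + g' d + c * ‖d‖ ^ 2) : HasFDerivAt g g' x := by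
  have hge (d : E) : g x + g' d - c * ‖d‖ ^ 2 ≤ g (x + d) := by
    have hmid := hg.2 (mem_univ (x + d)) (mem_univ (x + -d)) (by norm_num : (0 : ℝ) ≤ 1 / 2)
      (by norm_num : (0 : ℝ) ≤ 1 / 2) (by norm_num)
    rw [show (1 / 2 : ℝ) • (x + d) + (1 / 2 : ℝ) • (x + -d) = x by module] at hmid
    have hneg := hle (-d)
    rw [map_neg, norm_neg] at hneg
    simp only [smul_eq_mul] at hmid
    linarith
  rw [hasFDerivAt_iff_isLittleO_nhds_zero]
  refine Asymptotics.IsBigO.trans_isLittleO (g := fun d : E => ‖d‖ ^ 2)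
    (Asymptotics.IsBigO.of_bound c (Eventually.of_forall fun d => ?_))
    ((Asymptotics.isLittleO_pow_id (𝕜 := ℝ) one_lt_two).comp_tendsto
      (tendsto_norm_zero (E := E))).of_norm_right
  rw [Real.norm_eq_abs, norm_pow, norm_norm, abs_le]
  constructor <;> linarith [hle d, hge d]

variable {E : Type*} [NormedAddCommGroup E] [InnerProductSpace ℝ E] {ψ : E → ℝ} {p s : E}

theorem subdiff_nonempty [CompleteSpace E] (hψ : ConvexOn ℝ univ ψ) (hcont : Continuous ψ)
    (x : E) : (subdiff ψ x).Nonempty := by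
  obtain ⟨g, hg⟩ := exists_clm_add_le_of_convexOn hψ hcont x
  exact ⟨(InnerProductSpace.toDual ℝ E).symm g, by
    simpa only [subdiff, mem_ofPred_eq, InnerProductSpace.toDual_symm_apply] using hg⟩

theorem norm_le_of_mem_subdiff {M : ℝ} (hs : s ∈ subdiff ψ p)
    (hM : ∀ q ∈ Metric.closedBall p 1, ψ q ≤ M) : ‖s‖ ≤ M - ψ p := by
  have hball : p + ‖s‖⁻¹ • s ∈ Metric.closedBall p 1 := by
    simpa [norm_smul] using inv_mul_le_one
  have hinner : inner ℝ s (‖s‖⁻¹ • s) = ‖s‖ := by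
    rcases eq_or_ne s 0 with rfl | hs0
    · simp
    · rw [real_inner_smul_right, real_inner_self_eq_norm_sq]
      field_simp [norm_ne_zero_iff.2 hs0]
  have := (hs _).trans (hM _ hball)
  rw [add_sub_cancel_left, hinner] at this
  linarith

theorem eq_gradient_of_mem_subdiff [CompleteSpace E] (hs : s ∈ subdiff ψ p)
    (hd : DifferentiableAt ℝ ψ p) : s = gradient ψ p := by
  have hmin : IsLocalMin (fun y => ψ y - innerSL ℝ s y) p :=
    Eventually.of_forall fun y => by
      have := hs y
      rw [inner_sub_right] at this
      simp only [innerSL_apply_apply]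
      linarith
  have hzero := hmin.hasFDerivAt_eq_zero (hd.hasFDerivAt.sub (innerSL ℝ s).hasFDerivAt)
  rw [gradient, sub_eq_zero.1 hzero]
  exact ((InnerProductSpace.toDual ℝ E).symm_apply_apply s).symm

theorem gradient_mem_subdiff [CompleteSpace E] (hψ : ConvexOn ℝ univ ψ) (hcont : Continuous ψ)
    (hd : DifferentiableAt ℝ ψ p) : gradient ψ p ∈ subdiff ψ p := by
  obtain ⟨s, hs⟩ := subdiff_nonempty hψ hcont p
  exact eq_gradient_of_mem_subdiff hs hd ▸ hs

section FiniteDimensional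

variable [FiniteDimensional ℝ E] {ι : Type*} {l : Filter ι} {ψk : ι → E → ℝ} {pk sk : ι → E}

theorem tendsto_subgradient (hψ : ConvexOn ℝ univ ψ) (hsub : subdiff ψ p ⊆ {s})
    (hle : ∀ᶠ k in l, ψk k ≤ ψ) (hpk : Tendsto pk l (𝓝 p))
    (hval : Tendsto (fun k => ψk k (pk k)) l (𝓝 (ψ p)))
    (hsk : ∀ᶠ k in l, sk k ∈ subdiff (ψk k) (pk k)) : Tendsto sk l (𝓝 s) := by
  obtain ⟨M, hM⟩ := (isCompact_closedBall p 2).exists_bound_of_continuousOn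
    hψ.locallyLipschitz.continuous.continuousOn
  have hbounded : ∀ᶠ k in l, sk k ∈ Metric.closedBall (0 : E) (M - (ψ p - 1)) := by
    filter_upwards [hle, hsk, hpk (Metric.closedBall_mem_nhds p one_pos),
      hval.eventually_const_le (sub_one_lt _)] with k hle_k hsk_k hpk_k hval_k
    rw [mem_closedBall_zero_iff]
    refine (norm_le_of_mem_subdiff hsk_k fun q hq => ?_).trans (sub_le_sub_left hval_k M)
    refine (hle_k q).trans ((le_abs_self _).trans (hM q ?_))
    exact (dist_triangle _ _ _).trans ((add_le_add hq hpk_k).trans_eq one_add_one_eq_two)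
  refine (isCompact_closedBall (0 : E) _).tendsto_nhds_of_unique_mapClusterPt hbounded
    fun s' _ hs' => hsub fun q => ?_
  obtain ⟨u, hu, hus⟩ := mapClusterPt_iff_ultrafilter.1 hs'
  refine le_of_tendsto ((hval.mono_left hu).add
    (hus.inner (tendsto_const_nhds.sub (hpk.mono_left hu)))) ?_
  filter_upwards [hu hle, hu hsk] with k hle_k hsk_k
  exact (hsk_k q).trans (hle_k q)

theorem hasFDerivAt_of_subdiff_eq_singleton (hψ : ConvexOn ℝ univ ψ) (hs : subdiff ψ p = {s}) :
    HasFDerivAt ψ (innerSL ℝ s) p := by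
  have hcont := hψ.locallyLipschitz.continuous
  choose g hg using subdiff_nonempty hψ hcont
  have hlim : Tendsto g (𝓝 p) (𝓝 s) :=
    tendsto_subgradient hψ hs.subset (ψk := fun _ => ψ) (Eventually.of_forall fun _ => le_rfl)
      tendsto_id (hcont.tendsto p) (Eventually.of_forall hg)
  have hsp : s ∈ subdiff ψ p := hs ▸ rfl
  rw [hasFDerivAt_iff_isLittleO, Asymptotics.isLittleO_iff]
  intro ε hε
  filter_upwards [hlim (Metric.ball_mem_nhds s hε)] with y hy
  rw [innerSL_apply_apply, Real.norm_eq_abs, abs_of_nonneg (by linarith [hsp y])]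
  have hgap : ψ y - ψ p - inner ℝ s (y - p) ≤ inner ℝ (g y - s) (y - p) := by
    have := hg y p
    rw [← neg_sub y p, inner_neg_right] at this
    rw [inner_sub_left]
    linarith
  refine (hgap.trans (real_inner_le_norm _ _)).trans ?_
  gcongr
  exact (mem_ball_iff_norm.1 hy).le

theorem tendsto_fderiv_of_convexOn_minorants (hψ : ConvexOn ℝ univ ψ)
    (hd : DifferentiableAt ℝ ψ p) (hψk : ∀ᶠ k in l, ConvexOn ℝ univ (ψk k))
    (hdk : ∀ᶠ k in l, DifferentiableAt ℝ (ψk k) (pk k)) (hle : ∀ᶠ k in l, ψk k ≤ ψ)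
    (hpk : Tendsto pk l (𝓝 p)) (hval : Tendsto (fun k => ψk k (pk k)) l (𝓝 (ψ p))) :
    Tendsto (fun k => fderiv ℝ (ψk k) (pk k)) l (𝓝 (fderiv ℝ ψ p)) := by
  have hgrad : Tendsto (fun k => gradient (ψk k) (pk k)) l (𝓝 (gradient ψ p)) :=
    tendsto_subgradient hψ (fun s hs => eq_gradient_of_mem_subdiff hs hd) hle hpk hval <| by
      filter_upwards [hψk, hdk] with k hψk_k hdk_k
      exact gradient_mem_subdiff hψk_k hψk_k.locallyLipschitz.continuous hdk_k
  simpa only [gradient, Function.comp_def, LinearIsometryEquiv.apply_symm_apply] using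
    ((InnerProductSpace.toDual ℝ E).continuous.tendsto _).comp hgrad

end FiniteDimensional

end ConvexAnalysis

section MoreauEnvelope

variable {E : Type*} [NormedAddCommGroup E] [InnerProductSpace ℝ E] {ψ : E → ℝ} {p s : E}
  {lam : ℝ}

theorem le_prox_objective (hs : s ∈ subdiff ψ p) (hlam : 0 < lam) (x q : E) :
    ψ p + inner ℝ s (x - p) - lam / 2 * ‖s‖ ^ 2 ≤ ψ q + 1 / (2 * lam) * ‖x - q‖ ^ 2 := by
  have hsq : 0 ≤ 1 / (2 * lam) * ‖lam • s - (x - q)‖ ^ 2 := by positivity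
  have hexpand : 1 / (2 * lam) * ‖lam • s - (x - q)‖ ^ 2 =
      lam / 2 * ‖s‖ ^ 2 - inner ℝ s (x - q) + 1 / (2 * lam) * ‖x - q‖ ^ 2 := by
    rw [norm_sub_sq_real, norm_smul, real_inner_smul_left, Real.norm_of_nonneg hlam.le]
    field_simp
  have hsplit : inner ℝ s (x - p) = inner ℝ s (q - p) + inner ℝ s (x - q) := by
    rw [← inner_add_right, sub_add_sub_cancel']
  linarith [hs q]

theorem le_moreau (hs : s ∈ subdiff ψ p) (hlam : 0 < lam) (x : E) :
    ψ p + inner ℝ s (x - p) - lam / 2 * ‖s‖ ^ 2 ≤ moreau ψ lam x :=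
  le_ciInf (le_prox_objective hs hlam x)

theorem moreau_le (hs : s ∈ subdiff ψ p) (hlam : 0 < lam) (x q : E) :
    moreau ψ lam x ≤ ψ q + 1 / (2 * lam) * ‖x - q‖ ^ 2 :=
  ciInf_le ⟨_, forall_mem_range.2 (le_prox_objective hs hlam x)⟩ q

theorem moreau_le_self (hs : s ∈ subdiff ψ p) (hlam : 0 < lam) : moreau ψ lam ≤ ψ := fun x => by
  simpa using moreau_le hs hlam x x

theorem tendsto_moreau (hs : s ∈ subdiff ψ p) (hcont : ContinuousAt ψ p) {ι : Type*}
    {l : Filter ι} {lam : ι → ℝ} (hpos : ∀ᶠ k in l, 0 < lam k) (hlam : Tendsto lam l (𝓝 0))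
    {pk : ι → E} (hpk : Tendsto pk l (𝓝 p)) :
    Tendsto (fun k => moreau ψ (lam k) (pk k)) l (𝓝 (ψ p)) := by
  have hlower : Tendsto (fun k => ψ p + inner ℝ s (pk k - p) - lam k / 2 * ‖s‖ ^ 2) l
      (𝓝 (ψ p + inner ℝ s (p - p) - 0 / 2 * ‖s‖ ^ 2)) :=
    (tendsto_const_nhds.add (tendsto_const_nhds.inner (hpk.sub_const p))).sub
      ((hlam.div_const 2).mul_const _)
  simp only [sub_self, inner_zero_right, zero_div, zero_mul, add_zero, sub_zero] at hlower
  exact tendsto_of_tendsto_of_tendsto_of_le_of_le' hlower (hcont.tendsto.comp hpk)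
    (hpos.mono fun k hk => le_moreau hs hk _) (hpos.mono fun k hk => moreau_le_self hs hk _)

variable [FiniteDimensional ℝ E]

theorem tendsto_prox_objective_cocompact (hs : s ∈ subdiff ψ p) (hlam : 0 < lam) (x : E) :
    Tendsto (fun q => ψ q + 1 / (2 * lam) * ‖x - q‖ ^ 2) (cocompact E) atTop := by
  have hnorm : Tendsto (fun q => ‖x - q‖) (cocompact E) atTop :=
    tendsto_norm_cocompact_atTop.comp
      (Homeomorph.subLeft x).isClosedEmbedding.tendsto_cocompact
  refine tendsto_atTop_mono (fun q => ?_) (tendsto_atTop_add_const_left _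
    (ψ p + inner ℝ s (x - p) - lam * ‖s‖ ^ 2) (((tendsto_pow_atTop two_ne_zero).comp
      hnorm).const_mul_atTop (show 0 < 1 / (4 * lam) by positivity)))
  have hdouble := le_prox_objective hs (lam := 2 * lam) (by positivity) x q
  have hquarter : 1 / (2 * lam) = 1 / (4 * lam) + 1 / (2 * (2 * lam)) := by field_simp; norm_num
  have : 0 ≤ 1 / (4 * lam) * ‖x - q‖ ^ 2 := by positivity
  rw [hquarter, add_mul]
  simp only [Function.comp_apply]
  linarith

variable (hψ : ConvexOn ℝ univ ψ) (hlam : 0 < lam)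
include hψ hlam

theorem exists_moreau_eq (x : E) :
    ∃ q, moreau ψ lam x = ψ q + 1 / (2 * lam) * ‖x - q‖ ^ 2 := by
  have hcont := hψ.locallyLipschitz.continuous
  obtain ⟨s, hs⟩ := subdiff_nonempty hψ hcont x
  obtain ⟨q, hq⟩ := (show Continuous fun q => ψ q + 1 / (2 * lam) * ‖x - q‖ ^ 2 by
    fun_prop).exists_forall_le (tendsto_prox_objective_cocompact hs hlam x)
  exact ⟨q, le_antisymm (moreau_le hs hlam x q) (le_ciInf hq)⟩

theorem convexOn_moreau : ConvexOn ℝ univ (moreau ψ lam) := by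
  refine ⟨convex_univ, fun x _ y _ a b ha hb hab => ?_⟩
  obtain ⟨s, hs⟩ := subdiff_nonempty hψ hψ.locallyLipschitz.continuous x
  obtain ⟨p, hp⟩ := exists_moreau_eq hψ hlam x
  obtain ⟨q, hq⟩ := exists_moreau_eq hψ hlam y
  have hval := hψ.2 (mem_univ p) (mem_univ q) ha hb hab
  have hsq := ((convexOn_norm (E := E) convex_univ).pow (fun _ _ => norm_nonneg _) 2).2
    (mem_univ (x - p)) (mem_univ (y - q)) ha hb hab
  calc moreau ψ lam (a • x + b • y)
      ≤ ψ (a • p + b • q) + 1 / (2 * lam) * ‖a • x + b • y - (a • p + b • q)‖ ^ 2 :=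
        moreau_le hs hlam _ _
    _ = ψ (a • p + b • q) + 1 / (2 * lam) * ‖a • (x - p) + b • (y - q)‖ ^ 2 := by
        congr 4; module
    _ ≤ (a * ψ p + b * ψ q) + 1 / (2 * lam) * (a * ‖x - p‖ ^ 2 + b * ‖y - q‖ ^ 2) := by
        gcongr <;> assumption
    _ = a • moreau ψ lam x + b • moreau ψ lam y := by
        rw [hp, hq, smul_eq_mul, smul_eq_mul]; ring

theorem differentiable_moreau : Differentiable ℝ (moreau ψ lam) := by
  intro x
  obtain ⟨s, hs⟩ := subdiff_nonempty hψ hψ.locallyLipschitz.continuous x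
  obtain ⟨q, hq⟩ := exists_moreau_eq hψ hlam x
  refine (hasFDerivAt_of_convexOn_of_le_quadratic (convexOn_moreau hψ hlam)
    (g' := (1 / lam) • innerSL ℝ (x - q)) (c := 1 / (2 * lam)) fun d => ?_).differentiableAt
  have hle := moreau_le hs hlam (x + d) q
  rw [show x + d - q = (x - q) + d by abel, norm_add_sq_real] at hle
  refine hle.trans_eq ?_
  rw [hq]
  simp only [smul_apply, innerSL_apply_apply, smul_eq_mul]
  field_simp
  ring

end MoreauEnvelope

section UniformSlater

variable {H Z : Type*} [NormedAddCommGroup H] [NormedAddCommGroup Z] [NormedSpace ℝ Z]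

/-- A Slater condition for the constraint `G (x, z) ≤ 0`, uniform in `x` near `x₀`: the feasible
sets are convex and contain a common ball, and the feasible set at `x`, shrunk towards the origin
by a factor which depends affinely on the distance from `x` to `y`, is feasible at `y`. One
parameter `δ` measures the neighbourhood of `x₀`, the common ball and the rate of shrinking. -/
structure IsUniformSlater (G : H × Z → ℝ) (x₀ : H) (δ : ℝ) : Prop where
  pos : 0 < δ
  convexOn : ∀ x ∈ Metric.ball x₀ δ, ConvexOn ℝ univ fun z => G (x, z)
  neg_of_norm_le : ∀ x ∈ Metric.ball x₀ δ, ∀ z, ‖z‖ ≤ δ → G (x, z) < 0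
  shrink : ∀ x ∈ Metric.ball x₀ δ, ∀ y ∈ Metric.ball x₀ δ, ∀ z, G (x, z) ≤ 0 →
    G (y, (1 - ‖y - x‖ / (2 * δ)) • z) ≤ 0

theorem norm_sub_div_lt_one_of_mem_ball {x₀ x y : H} {δ : ℝ} (hx : x ∈ Metric.ball x₀ δ)
    (hy : y ∈ Metric.ball x₀ δ) : ‖y - x‖ / (2 * δ) < 1 := by
  have hδ : 0 < δ := Metric.pos_of_mem_ball hx
  rw [div_lt_one (by positivity), ← dist_eq_norm]
  linarith [dist_triangle_right y x x₀, Metric.mem_ball.1 hx, Metric.mem_ball.1 hy]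

variable [NormedSpace ℝ H] {T S : H × Z → ℝ} {h : H → ℝ} {x₀ : H} {δ b ε : ℝ} {κ : ℝ≥0}

theorem sub_nonpos_of_shrink (hT : ConvexOn ℝ univ T)
    (hTb : ∀ p ∈ Metric.ball (x₀, (0 : Z)) (3 * δ), T p ≤ b - ε)
    (hb : ∀ x ∈ Metric.ball x₀ δ, b ≤ h x) (hlip : LipschitzOnWith κ h (Metric.ball x₀ δ))
    (hκ : κ * (2 * δ) ≤ ε) {x y : H} (hx : x ∈ Metric.ball x₀ δ) (hy : y ∈ Metric.ball x₀ δ)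
    {z : Z} (hz : T (x, z) - h x ≤ 0) :
    T (y, (1 - ‖y - x‖ / (2 * δ)) • z) - h y ≤ 0 := by
  rcases eq_or_ne y x with rfl | hne
  · simpa using hz
  have hδ : 0 < δ := Metric.pos_of_mem_ball hx
  have hα_lt := norm_sub_div_lt_one_of_mem_ball hx hy
  have hyx : ‖y - x‖ = ‖y - x‖ / (2 * δ) * (2 * δ) := by field_simp
  have hα : 0 < ‖y - x‖ / (2 * δ) := div_pos (norm_pos_iff.2 (sub_ne_zero.2 hne)) (by positivity)
  set α := ‖y - x‖ / (2 * δ)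
  -- `w` is the point beyond `y` on the ray from `x` at distance `2 δ`.
  set w := x + α⁻¹ • (y - x) with hw
  have hw_mem : (w, (0 : Z)) ∈ Metric.ball (x₀, (0 : Z)) (3 * δ) := by
    have hwx : ‖w - x‖ = 2 * δ := by
      rw [hw, add_sub_cancel_left, norm_smul, norm_inv, Real.norm_of_nonneg hα.le, hyx,
        inv_mul_cancel_left₀ hα.ne']
    rw [← ball_prod_same]
    refine ⟨?_, Metric.mem_ball_self (by positivity)⟩
    rw [Metric.mem_ball] at hx ⊢
    linarith [dist_triangle w x x₀, dist_eq_norm w x]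
  have hcomb := hT.2 (mem_univ (x, z)) (mem_univ (w, (0 : Z))) (sub_nonneg.2 hα_lt.le) hα.le
    (sub_add_cancel 1 α)
  have hw_comb : (1 - α) • (x, z) + α • (w, (0 : Z)) = (y, (1 - α) • z) := by
    refine Prod.ext ?_ (by simp)
    simp only [hw, Prod.fst_add, Prod.smul_fst, smul_add, smul_inv_smul₀ hα.ne']
    module
  rw [hw_comb] at hcomb
  refine sub_nonpos.2 ?_
  calc T (y, (1 - α) • z) ≤ (1 - α) * T (x, z) + α * T (w, 0) := hcomb
    _ ≤ (1 - α) * h x + α * (h x - ε) := by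
        have := sub_nonneg.2 hα_lt.le
        gcongr
        · exact sub_nonpos.1 hz
        · linarith [hTb _ hw_mem, hb x hx]
    _ = h x - α * ε := by ring
    _ ≤ h x - κ * dist x y := by
        rw [dist_comm, dist_eq_norm, hyx, mul_left_comm]
        gcongr
    _ ≤ h y := by linarith [hlip.dist_le_mul x hx y hy, Real.dist_eq (h x) (h y),
        le_abs_self (h x - h y)]

theorem isUniformSlater_sub_comp_fst (hδ : 0 < δ) (hε : 0 < ε) (hT : ConvexOn ℝ univ T)
    (hTb : ∀ p ∈ Metric.ball (x₀, (0 : Z)) (3 * δ), T p ≤ b - ε)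
    (hb : ∀ x ∈ Metric.ball x₀ δ, b ≤ h x) (hlip : LipschitzOnWith κ h (Metric.ball x₀ δ))
    (hκ : κ * (2 * δ) ≤ ε) : IsUniformSlater (fun p => T p - h p.1) x₀ δ where
  pos := hδ
  convexOn x _ := by
    refine ConvexOn.sub (f := fun z => T (x, z)) ⟨convex_univ, fun z _ w _ s t hs ht hst => ?_⟩
      (concaveOn_const (h x) convex_univ)
    have := hT.2 (mem_univ (x, z)) (mem_univ (x, w)) hs ht hst
    rwa [Prod.smul_mk, Prod.smul_mk, Prod.mk_add_mk, ← add_smul, hst, one_smul] at this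
  neg_of_norm_le x hx z hz := by
    have hxz : (x, z) ∈ Metric.ball (x₀, (0 : Z)) (3 * δ) := by
      rw [← ball_prod_same]
      exact ⟨Metric.ball_subset_ball (by linarith) hx, mem_ball_zero_iff.2 (by linarith)⟩
    linarith [hTb _ hxz, hb x hx]
  shrink _ hx _ hy _ hz := sub_nonpos_of_shrink hT hTb hb hlip hκ hx hy hz

theorem exists_isUniformSlater_sub_comp_fst (hS : ContinuousAt S (x₀, 0))
    (hlip : ∃ U ∈ 𝓝 x₀, LipschitzOnWith κ h U) (hsl : S (x₀, 0) < h x₀) :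
    ∃ δ, ∀ T : H × Z → ℝ, ConvexOn ℝ univ T → T ≤ S →
      IsUniformSlater (fun p => T p - h p.1) x₀ δ := by
  obtain ⟨U, hU, hlip⟩ := hlip
  obtain ⟨b, hSb, hbh⟩ := exists_between hsl
  obtain ⟨c, hSc, hcb⟩ := exists_between hSb
  have hh : ContinuousAt h x₀ := hlip.continuousOn.continuousAt hU
  obtain ⟨d, hd, hd_sub⟩ := Metric.eventually_nhds_iff_ball.1
    ((eventually_mem_set.2 hU).and (hh.eventually (lt_mem_nhds hbh)))
  obtain ⟨e, he, he_sub⟩ := Metric.eventually_nhds_iff_ball.1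
    (hS.eventually (gt_mem_nhds hSc))
  have hsmall : ∀ᶠ δ in 𝓝[>] (0 : ℝ), 0 < δ ∧ δ < d ∧ 3 * δ < e ∧ κ * (2 * δ) < b - c := by
    have hzero {g : ℝ → ℝ} (hg : Continuous g) (hg0 : g 0 = 0) {t : ℝ} (ht : 0 < t) :
        ∀ᶠ δ in 𝓝[>] (0 : ℝ), g δ < t :=
      ((hg.tendsto' 0 0 hg0).mono_left nhdsWithin_le_nhds).eventually (gt_mem_nhds ht)
    filter_upwards [self_mem_nhdsWithin, hzero continuous_id rfl hd,
      hzero (continuous_const_mul 3) (mul_zero 3) he,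
      hzero (g := fun δ => κ * (2 * δ)) (by fun_prop) (by simp) (sub_pos.2 hcb)]
      with δ h₀ h₁ h₂ h₃ using ⟨h₀, h₁, h₂, h₃⟩
  obtain ⟨δ, hδ, hδd, hδe, hκ⟩ := hsmall.exists
  have hball := Metric.ball_subset_ball (x := x₀) hδd.le
  refine ⟨δ, fun T hT hTS => isUniformSlater_sub_comp_fst hδ (sub_pos.2 hcb) hT (fun p hp => ?_)
    (fun x hx => (hd_sub x (hball hx)).2.le) (hlip.mono fun x hx => (hd_sub x (hball hx)).1)
    hκ.le⟩
  rw [sub_sub_cancel]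
  exact (hTS p).trans (he_sub p (Metric.ball_subset_ball hδe.le hp)).le

end UniformSlater

section InvRadius

variable {H Z : Type*} [NormedAddCommGroup Z] [NormedSpace ℝ Z]

/-- The reciprocal of the distance, in multiples of `a`, from the origin to the boundary of
`{z | G (x, z) ≤ 0}` in the direction `a`. It is used instead of the distance itself since it stays
finite, with value `0`, in the directions in which the set is unbounded. -/
noncomputable def invRadius (G : H × Z → ℝ) (x : H) (a : Z) : ℝ :=
  sInf {t : ℝ | 0 < t ∧ G (x, t⁻¹ • a) ≤ 0}

theorem invRadius_nonneg (G : H × Z → ℝ) (x : H) (a : Z) : 0 ≤ invRadius G x a :=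
  Real.sInf_nonneg fun _ ht => ht.1.le

theorem invRadius_le_of_nonpos {G : H × Z → ℝ} {x : H} {a : Z} {t : ℝ} (ht : 0 < t)
    (hG : G (x, t⁻¹ • a) ≤ 0) : invRadius G x a ≤ t :=
  csInf_le ⟨0, fun _ hs => hs.1.le⟩ ⟨ht, hG⟩

variable [NormedAddCommGroup H] {G : H × Z → ℝ} {x₀ x y : H} {a : Z} {δ s t : ℝ}

namespace IsUniformSlater

section Order

variable (hG : IsUniformSlater G x₀ δ) (hx : x ∈ Metric.ball x₀ δ)
include hG hx

theorem convexOn_ray (a : Z) : ConvexOn ℝ univ fun t : ℝ => G (x, t • a) :=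
  (hG.convexOn x hx).comp_linearMap (LinearMap.toSpanSingleton ℝ Z a)

theorem apply_zero_neg : G (x, 0) < 0 :=
  hG.neg_of_norm_le x hx 0 (by simpa using hG.pos.le)

theorem neg_of_lt (hs : 0 < s) (hst : s < t) (h : G (x, s⁻¹ • a) ≤ 0) : G (x, t⁻¹ • a) < 0 := by
  have ht : 0 < t := hs.trans hst
  have hlt : s / t < 1 := (div_lt_one ht).2 hst
  have hcomb := (hG.convexOn_ray hx a).2 (mem_univ s⁻¹) (mem_univ 0) (by positivity : 0 ≤ s / t)
    (sub_nonneg.2 hlt.le) (add_sub_cancel (s / t) 1)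
  have heq : s / t * s⁻¹ = t⁻¹ := by field_simp
  simp only [smul_eq_mul, mul_zero, add_zero, heq, zero_smul] at hcomb
  have := mul_nonpos_of_nonneg_of_nonpos (by positivity : 0 ≤ s / t) h
  have := mul_neg_of_pos_of_neg (sub_pos.2 hlt) (hG.apply_zero_neg hx)
  linarith

theorem exists_nonpos_of_invRadius_lt (ht : invRadius G x a < t) :
    ∃ s, 0 < s ∧ s < t ∧ G (x, s⁻¹ • a) ≤ 0 := by
  have hδ := hG.pos
  have hlarge : 0 < ‖a‖ / δ + 1 := by positivity
  have hnonempty : {t : ℝ | 0 < t ∧ G (x, t⁻¹ • a) ≤ 0}.Nonempty := by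
    refine ⟨‖a‖ / δ + 1, hlarge, (hG.neg_of_norm_le x hx _ ?_).le⟩
    rw [norm_smul, norm_inv, Real.norm_of_nonneg hlarge.le, inv_mul_le_iff₀ hlarge, add_mul,
      div_mul_cancel₀ _ hδ.ne']
    linarith
  obtain ⟨s, ⟨hs, hsG⟩, hst⟩ := exists_lt_of_csInf_lt hnonempty ht
  exact ⟨s, hs, hst, hsG⟩

theorem neg_of_invRadius_lt (ht : invRadius G x a < t) : G (x, t⁻¹ • a) < 0 := by
  obtain ⟨s, hs, hst, hsG⟩ := hG.exists_nonpos_of_invRadius_lt hx ht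
  exact hG.neg_of_lt hx hs hst hsG

theorem continuousAt_inv_smul (ht : t ≠ 0) : ContinuousAt (fun s : ℝ => G (x, s⁻¹ • a)) t :=
  (hG.convexOn_ray hx a).locallyLipschitz.continuous.continuousAt.comp (continuousAt_inv₀ ht)

theorem invRadius_le_iff (ht : 0 < t) : invRadius G x a ≤ t ↔ G (x, t⁻¹ • a) ≤ 0 := by
  refine ⟨fun hle => ?_, invRadius_le_of_nonpos ht⟩
  refine le_of_tendsto ((hG.continuousAt_inv_smul hx ht.ne').tendsto.mono_left
    (nhdsWithin_le_nhds (s := Ioi t))) ?_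
  filter_upwards [self_mem_nhdsWithin] with s hs
    using (hG.neg_of_invRadius_lt hx (hle.trans_lt hs)).le

theorem apply_eq_zero_of_invRadius_pos (hτ : 0 < invRadius G x a) :
    G (x, (invRadius G x a)⁻¹ • a) = 0 := by
  refine le_antisymm ((hG.invRadius_le_iff hx hτ).1 le_rfl) ?_
  refine ge_of_tendsto ((hG.continuousAt_inv_smul hx hτ.ne').tendsto.mono_left
    (nhdsWithin_le_nhds (s := Iio (invRadius G x a)))) ?_
  filter_upwards [self_mem_nhdsWithin, nhdsWithin_le_nhds (lt_mem_nhds hτ)] with s hs hs0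
  exact (not_le.1 fun hle => not_le.2 hs ((hG.invRadius_le_iff hx hs0).2 hle)).le

theorem invRadius_le : invRadius G x a ≤ ‖a‖ / δ := by
  have hδ := hG.pos
  refine le_of_forall_gt_imp_ge_of_dense fun t ht => ?_
  have ht0 : 0 < t := (div_nonneg (norm_nonneg a) hδ.le).trans_lt ht
  refine invRadius_le_of_nonpos ht0 (hG.neg_of_norm_le x hx _ ?_).le
  rw [norm_smul, norm_inv, Real.norm_of_nonneg ht0.le, inv_mul_le_iff₀ ht0]
  exact ((div_lt_iff₀ hδ).1 ht).le

variable (hy : y ∈ Metric.ball x₀ δ)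
include hy

theorem mul_invRadius_le : (1 - ‖y - x‖ / (2 * δ)) * invRadius G y a ≤ invRadius G x a := by
  have hβ : 0 < 1 - ‖y - x‖ / (2 * δ) := sub_pos.2 (norm_sub_div_lt_one_of_mem_ball hx hy)
  refine le_of_forall_gt_imp_ge_of_dense fun t ht => ?_
  have ht0 : 0 < t := (invRadius_nonneg G x a).trans_lt ht
  have hshrink := hG.shrink x hx y hy _ (hG.neg_of_invRadius_lt hx ht).le
  rw [← le_div_iff₀' hβ]
  refine invRadius_le_of_nonpos (by positivity) ?_
  rwa [inv_div, div_eq_mul_inv, mul_smul]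

theorem invRadius_sub_le :
    invRadius G y a - invRadius G x a ≤ ‖a‖ / (2 * δ ^ 2) * ‖y - x‖ := by
  have hδ := hG.pos
  calc invRadius G y a - invRadius G x a ≤ ‖y - x‖ / (2 * δ) * invRadius G y a := by
        linarith [hG.mul_invRadius_le hx hy (a := a)]
    _ ≤ ‖y - x‖ / (2 * δ) * (‖a‖ / δ) := by gcongr; exact hG.invRadius_le hy
    _ = ‖a‖ / (2 * δ ^ 2) * ‖y - x‖ := by field_simp

theorem abs_invRadius_sub_le :
    |invRadius G y a - invRadius G x a| ≤ ‖a‖ / (2 * δ ^ 2) * ‖y - x‖ := by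
  refine abs_sub_le_iff.2 ⟨hG.invRadius_sub_le hx hy, ?_⟩
  rw [norm_sub_rev]
  exact hG.invRadius_sub_le hy hx

end Order

theorem isBigO_invRadius_sub (hG : IsUniformSlater G x₀ δ) (hx : x ∈ Metric.ball x₀ δ) (a : Z) :
    (fun y => invRadius G y a - invRadius G x a) =O[𝓝 x] fun y => y - x := by
  refine Asymptotics.IsBigO.of_bound (‖a‖ / (2 * δ ^ 2)) ?_
  filter_upwards [Metric.isOpen_ball.mem_nhds hx] with y hy
  exact hG.abs_invRadius_sub_le hx hy

theorem continuousAt_invRadius (hG : IsUniformSlater G x₀ δ) (hx : x ∈ Metric.ball x₀ δ) (a : Z) :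
    ContinuousAt (fun y => invRadius G y a) x :=
  tendsto_sub_nhds_zero_iff.1 <|
    (hG.isBigO_invRadius_sub hx a).trans_tendsto (tendsto_sub_nhds_zero_iff.2 tendsto_id)

theorem tendsto_invRadius {ι : Type*} {l : Filter ι} {Gk : ι → H × Z → ℝ} {xk : ι → H}
    (hG : IsUniformSlater G x₀ δ) (hGk : ∀ᶠ k in l, IsUniformSlater (Gk k) x₀ δ)
    (hxk : Tendsto xk l (𝓝 x₀))
    (hlim : ∀ z, Tendsto (fun k => Gk k (xk k, z)) l (𝓝 (G (x₀, z)))) (a : Z) :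
    Tendsto (fun k => invRadius (Gk k) (xk k) a) l (𝓝 (invRadius G x₀ a)) := by
  have hx₀ : x₀ ∈ Metric.ball x₀ δ := Metric.mem_ball_self hG.pos
  have hxk_mem : ∀ᶠ k in l, xk k ∈ Metric.ball x₀ δ := hxk (Metric.ball_mem_nhds x₀ hG.pos)
  refine tendsto_order.2 ⟨fun c hc => ?_, fun c hc => ?_⟩
  · rcases lt_or_ge c 0 with hc0 | hc0
    · exact Eventually.of_forall fun k => hc0.trans_le (invRadius_nonneg _ _ _)
    obtain ⟨d, hcd, hd⟩ := exists_between hc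
    have hd0 : 0 < d := hc0.trans_lt hcd
    have hpos : 0 < G (x₀, d⁻¹ • a) :=
      not_le.1 fun hle => not_le.2 hd ((hG.invRadius_le_iff hx₀ hd0).2 hle)
    filter_upwards [(hlim (d⁻¹ • a)).eventually (lt_mem_nhds hpos), hGk, hxk_mem]
      with k hpos_k hG_k hx_k
    exact hcd.trans (not_le.1 fun hle => not_le.2 hpos_k ((hG_k.invRadius_le_iff hx_k hd0).1 hle))
  · obtain ⟨d, hd, hdc⟩ := exists_between hc
    filter_upwards [(hlim (d⁻¹ • a)).eventually (gt_mem_nhds (hG.neg_of_invRadius_lt hx₀ hd))]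
      with k hneg_k
    exact (invRadius_le_of_nonpos ((invRadius_nonneg G x₀ a).trans_lt hd) hneg_k.le).trans_lt hdc

end IsUniformSlater

end InvRadius

theorem hasFDerivAt_of_eventually_eq_zero {E : Type*} [NormedAddCommGroup E] [NormedSpace ℝ E]
    {F : E × ℝ → ℝ} {F' : E × ℝ →L[ℝ] ℝ} {τ : E → ℝ} {x : E} (hF : HasFDerivAt F F' (x, τ x))
    (hτ : (fun y => τ y - τ x) =O[𝓝 x] fun y => y - x)
    (hzero : ∀ᶠ y in 𝓝 x, F (y, τ y) = 0) (hF' : F' (0, 1) ≠ 0) :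
    HasFDerivAt τ (-(F' (0, 1))⁻¹ • F'.comp (ContinuousLinearMap.inl ℝ E ℝ)) x := by
  have hτ_cont : Tendsto τ (𝓝 x) (𝓝 (τ x)) :=
    tendsto_sub_nhds_zero_iff.1 <| hτ.trans_tendsto (tendsto_sub_nhds_zero_iff.2 tendsto_id)
  have hgraph : (fun y => (y, τ y) - (x, τ x)) =O[𝓝 x] fun y => y - x :=
    (Asymptotics.isBigO_refl _ _).prod_left hτ
  have hlin : (fun y => F' ((y, τ y) - (x, τ x))) =o[𝓝 x] fun y => y - x := by
    have h := ((hF.isLittleO.comp_tendsto (tendsto_id.prodMk_nhds hτ_cont)).trans_isBigO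
      hgraph).neg_left
    refine h.congr' ?_ .rfl
    filter_upwards [hzero] with y hy
    simp only [Function.comp_apply, id_eq, hy, hzero.self_of_nhds, sub_self, zero_sub, neg_neg]
  refine .of_isLittleO ((hlin.const_mul_left (F' (0, 1))⁻¹).congr_left fun y => ?_)
  have hsplit : ((y, τ y) - (x, τ x) : E × ℝ) = (y - x, 0) + (τ y - τ x) • ((0 : E), (1 : ℝ)) := by
    simp
  rw [hsplit, map_add, map_smul, smul_eq_mul, mul_add, mul_left_comm, inv_mul_cancel₀ hF']
  simp only [smul_apply, ContinuousLinearMap.comp_apply, ContinuousLinearMap.inl_apply,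
    smul_eq_mul]
  ring

section InvRadiusDeriv

variable {H Z : Type*} [NormedAddCommGroup H] [NormedSpace ℝ H] [NormedAddCommGroup Z]
  [NormedSpace ℝ Z] {G : H × Z → ℝ} {x₀ x : H} {a : Z} {δ : ℝ}

/-- The derivative of `x ↦ invRadius G x a`, as given by the implicit function theorem. It is
meaningful only if `invRadius G x a` is positive and `G` is differentiable at the boundary point
`(x, (invRadius G x a)⁻¹ • a)`. -/
noncomputable def invRadiusDeriv (G : H × Z → ℝ) (x : H) (a : Z) : H →L[ℝ] ℝ :=
  let G' := fderiv ℝ G (x, (invRadius G x a)⁻¹ • a)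
  (invRadius G x a ^ 2 / G' (0, a)) • G'.comp (ContinuousLinearMap.inl ℝ H Z)

namespace IsUniformSlater

theorem fderiv_apply_pos (hG : IsUniformSlater G x₀ δ) (hx : x ∈ Metric.ball x₀ δ)
    (hτ : 0 < invRadius G x a) (hd : DifferentiableAt ℝ G (x, (invRadius G x a)⁻¹ • a)) :
    0 < fderiv ℝ G (x, (invRadius G x a)⁻¹ • a) (0, a) := by
  have hray : HasDerivAt (fun t : ℝ => (x, t • a)) (0, a) (invRadius G x a)⁻¹ := by
    simpa using (hasDerivAt_const _ x).prodMk ((hasDerivAt_id (invRadius G x a)⁻¹).smul_const a)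
  have hslope := (hG.convexOn_ray hx a).slope_le_of_hasDerivAt (mem_univ 0)
    (mem_univ (invRadius G x a)⁻¹) (inv_pos.2 hτ) (hd.hasFDerivAt.comp_hasDerivAt _ hray)
  refine lt_of_lt_of_le ?_ hslope
  rw [slope_def_field, hG.apply_eq_zero_of_invRadius_pos hx hτ, zero_smul, zero_sub, sub_zero]
  exact div_pos (neg_pos.2 (hG.apply_zero_neg hx)) (inv_pos.2 hτ)

theorem hasFDerivAt_invRadius (hG : IsUniformSlater G x₀ δ) (hx : x ∈ Metric.ball x₀ δ)
    (hτ : 0 < invRadius G x a) (hd : DifferentiableAt ℝ G (x, (invRadius G x a)⁻¹ • a)) :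
    HasFDerivAt (fun y => invRadius G y a) (invRadiusDeriv G x a) x := by
  have hinv := (hasDerivAt_inv hτ.ne').comp_hasFDerivAt (x, invRadius G x a)
    (hasFDerivAt_snd (𝕜 := ℝ) (E := H))
  have hpath := (hasFDerivAt_fst (𝕜 := ℝ) (p := (x, invRadius G x a))).prodMk (hinv.smul_const a)
  have hcomp := hd.hasFDerivAt.comp (x, invRadius G x a) hpath
  have hzero : ∀ᶠ y in 𝓝 x, G (y, (invRadius G y a)⁻¹ • a) = 0 := by
    filter_upwards [Metric.isOpen_ball.mem_nhds hx,
      (hG.continuousAt_invRadius hx a).eventually (lt_mem_nhds hτ)] with y hy hτy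
    exact hG.apply_eq_zero_of_invRadius_pos hy hτy
  have hpos := hG.fderiv_apply_pos hx hτ hd
  set G' := fderiv ℝ G (x, (invRadius G x a)⁻¹ • a) with hG'
  have hG'_neg_smul (c : ℝ) : G' (0, -(c • a)) = -(c * G' (0, a)) := by
    rw [← smul_eq_mul, ← map_smul, ← map_neg, Prod.smul_mk, Prod.neg_mk, smul_zero, neg_zero]
  refine (hasFDerivAt_of_eventually_eq_zero hcomp (hG.isBigO_invRadius_sub hx a) hzero
    ?_).congr_fderiv ?_
  · simp [hG'_neg_smul, hτ.ne', hpos.ne']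
  · ext v
    simp only [neg_smul, smul_apply, neg_apply, ContinuousLinearMap.comp_apply,
      ContinuousLinearMap.inl_apply, ContinuousLinearMap.prod_apply, ContinuousLinearMap.coe_fst',
      ContinuousLinearMap.smulRight_apply, ContinuousLinearMap.coe_snd', smul_eq_mul, mul_one,
      mul_zero, zero_smul, neg_zero, hG'_neg_smul, invRadiusDeriv, ← hG']
    field_simp

theorem norm_invRadiusDeriv_le (hG : IsUniformSlater G x₀ δ) (hx : x ∈ Metric.ball x₀ δ)
    (hτ : 0 < invRadius G x a) (hd : DifferentiableAt ℝ G (x, (invRadius G x a)⁻¹ • a)) :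
    ‖invRadiusDeriv G x a‖ ≤ ‖a‖ / (2 * δ ^ 2) := by
  refine (hG.hasFDerivAt_invRadius hx hτ hd).le_of_lip' (by positivity) ?_
  filter_upwards [Metric.isOpen_ball.mem_nhds hx] with y hy
  exact hG.abs_invRadius_sub_le hx hy

theorem tendsto_invRadiusDeriv {ι : Type*} {l : Filter ι} {Gk : ι → H × Z → ℝ} {xk : ι → H}
    (hG : IsUniformSlater G x₀ δ) (hτ : 0 < invRadius G x₀ a)
    (hd : DifferentiableAt ℝ G (x₀, (invRadius G x₀ a)⁻¹ • a))
    (hτk : Tendsto (fun k => invRadius (Gk k) (xk k) a) l (𝓝 (invRadius G x₀ a)))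
    (hdk : Tendsto (fun k => fderiv ℝ (Gk k) (xk k, (invRadius (Gk k) (xk k) a)⁻¹ • a)) l
      (𝓝 (fderiv ℝ G (x₀, (invRadius G x₀ a)⁻¹ • a)))) :
    Tendsto (fun k => invRadiusDeriv (Gk k) (xk k) a) l (𝓝 (invRadiusDeriv G x₀ a)) := by
  have hne := (hG.fderiv_apply_pos (Metric.mem_ball_self hG.pos) hτ hd).ne'
  exact ((hτk.pow 2).div (((ContinuousLinearMap.apply ℝ ℝ ((0 : H), a)).continuous.tendsto _).comp
    hdk) hne).smul (((ContinuousLinearMap.inl ℝ H Z).precomp ℝ).continuous.tendsto _ |>.comp hdk)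

end IsUniformSlater

end InvRadiusDeriv

section RadialDecay

variable {Z : Type*} [NormedAddCommGroup Z]

/-- The class of densities of the theorem, with `n` in the role of the dimension of `Z`: continuous
functions of order `o(‖z‖ ^ (-(n + 1)))` at infinity. -/
structure HasRadialDecay (n : ℕ) (f : Z → ℝ) : Prop where
  continuous : Continuous f
  tendsto : Tendsto (fun z => ‖z‖ ^ (n + 1) * f z) (Bornology.cobounded Z) (𝓝 0)

theorem HasRadialDecay.exists_bound [ProperSpace Z] {n : ℕ} {f : Z → ℝ}
    (hf : HasRadialDecay n f) : ∃ C, ∀ z, (1 + ‖z‖) ^ (n + 1) * |f z| ≤ C := by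
  have htail : ∀ᶠ z in Bornology.cobounded Z, |‖z‖ ^ (n + 1) * f z| ≤ 1 :=
    hf.tendsto.abs.eventually_le_const (abs_zero.trans_lt one_pos)
  obtain ⟨R, -, hR⟩ := (hasBasis_cobounded_norm (E := Z)).eventually_iff.1 htail
  have hcont : Continuous fun z => (1 + ‖z‖) ^ (n + 1) * |f z| := by
    have := hf.continuous
    fun_prop
  obtain ⟨M, hM⟩ := (isCompact_closedBall (0 : Z) (max R 1)).exists_bound_of_continuousOn
    hcont.continuousOn
  refine ⟨max M (2 ^ (n + 1)), fun z => ?_⟩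
  rcases le_total ‖z‖ (max R 1) with hz | hz
  · exact ((le_abs_self _).trans (hM z (mem_closedBall_zero_iff.2 hz))).trans (le_max_left _ _)
  · have hz_tail : |‖z‖ ^ (n + 1) * f z| ≤ 1 := hR ((le_max_left _ _).trans hz)
    have hz_one : 1 + ‖z‖ ≤ 2 * ‖z‖ := by linarith [(le_max_right R 1).trans hz]
    calc (1 + ‖z‖) ^ (n + 1) * |f z| ≤ (2 * ‖z‖) ^ (n + 1) * |f z| := by gcongr
      _ = 2 ^ (n + 1) * |‖z‖ ^ (n + 1) * f z| := by
        rw [abs_mul, abs_of_nonneg (by positivity : 0 ≤ ‖z‖ ^ (n + 1)), mul_pow, mul_assoc]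
      _ ≤ 2 ^ (n + 1) := mul_le_of_le_one_right (by positivity) hz_tail
      _ ≤ max M (2 ^ (n + 1)) := le_max_right _ _

theorem HasRadialDecay.const_mul {n : ℕ} {f : Z → ℝ} (hf : HasRadialDecay n f) (c : ℝ) :
    HasRadialDecay n fun z => c * f z where
  continuous := hf.continuous.const_mul c
  tendsto := by simpa [mul_left_comm] using hf.tendsto.const_mul c

variable [NormedSpace ℝ Z]

theorem HasRadialDecay.comp_continuousLinearEquiv {n : ℕ} {f : Z → ℝ} (hf : HasRadialDecay n f)
    (L : Z ≃L[ℝ] Z) : HasRadialDecay n fun z => f (L z) where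
  continuous := hf.continuous.comp L.continuous
  tendsto := by
    set M := ‖(L.symm : Z →L[ℝ] Z)‖
    refine squeeze_zero_norm (a := fun z => M ^ (n + 1) * ‖‖L z‖ ^ (n + 1) * f (L z)‖)
      (fun z => ?_) ?_
    · have hz : ‖z‖ ≤ M * ‖L z‖ := by
        simpa using (L.symm : Z →L[ℝ] Z).le_opNorm (L z)
      rw [norm_mul, norm_mul, norm_pow, norm_pow, norm_norm, norm_norm, ← mul_assoc, ← mul_pow]
      gcongr
    · simpa using ((hf.tendsto.comp L.antilipschitz.tendsto_cobounded).norm.const_mul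
        (M ^ (n + 1)))

theorem integrable_of_one_add_norm_pow_mul_abs_le [FiniteDimensional ℝ Z] [MeasurableSpace Z]
    [BorelSpace Z] {μ : Measure Z} [μ.IsAddHaarMeasure] {f : Z → ℝ} (hf : Continuous f) {k : ℕ}
    (hk : Module.finrank ℝ Z < k) {C : ℝ} (hC : ∀ z, (1 + ‖z‖) ^ k * |f z| ≤ C) :
    Integrable f μ := by
  refine ((integrable_one_add_norm (μ := μ) (Nat.cast_lt.2 hk)).const_mul C).mono'
    hf.aestronglyMeasurable (ae_of_all _ fun z => ?_)
  rw [Real.rpow_neg (by positivity), Real.rpow_natCast, ← div_eq_mul_inv,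
    le_div_iff₀' (by positivity)]
  exact hC z

theorem HasRadialDecay.integrable [FiniteDimensional ℝ Z] [MeasurableSpace Z] [BorelSpace Z]
    {μ : Measure Z} [μ.IsAddHaarMeasure] {f : Z → ℝ}
    (hf : HasRadialDecay (Module.finrank ℝ Z) f) : Integrable f μ :=
  let ⟨_, hC⟩ := hf.exists_bound
  integrable_of_one_add_norm_pow_mul_abs_le hf.continuous (Nat.lt_succ_self _) hC

/-- The density, in the variable `u = 1 / r`, of the mass that `f` puts on the ray of `v`: this is
`r ^ (n - 1) * f (r • v) * dr`. At `u = 0` the junk value of the inverse gives `0`, which is the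
limit of the density if `f` decays. -/
noncomputable def radialDensity (n : ℕ) (f : Z → ℝ) (v : Z) (u : ℝ) : ℝ :=
  u⁻¹ ^ (n + 1) * f (u⁻¹ • v)

theorem radialDensity_zero (n : ℕ) (f : Z → ℝ) (v : Z) : radialDensity n f v 0 = 0 := by
  simp [radialDensity]

variable {n : ℕ} {f : Z → ℝ} {v : Z} {C : ℝ}

theorem continuous_radialDensity (hf : HasRadialDecay n f) (hv : ‖v‖ = 1) :
    Continuous (radialDensity n f v) := by
  have hf_cont := hf.continuous
  refine continuous_iff_continuousAt.2 fun u => ?_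
  rcases eq_or_ne u 0 with rfl | hu
  · have hray : Tendsto (fun u : ℝ => u⁻¹ • v) (𝓝[≠] 0) (Bornology.cobounded Z) := by
      rw [← tendsto_norm_atTop_iff_cobounded]
      simpa [norm_smul, hv] using tendsto_norm_inv_nhdsNE_zero_atTop (α := ℝ)
    rw [continuousAt_iff_punctured_nhds, radialDensity_zero]
    refine squeeze_zero_norm (fun u => ?_) (by simpa using (hf.tendsto.comp hray).norm)
    simp [radialDensity, norm_smul, hv]
  · have := continuousAt_inv₀ hu
    unfold radialDensity
    fun_prop

theorem one_add_norm_pow_mul_abs_radialDensity_le (hC : ∀ z, (1 + ‖z‖) ^ (n + 1) * |f z| ≤ C)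
    (hv : ‖v‖ = 1) (u : ℝ) : (1 + ‖u‖) ^ (n + 1) * |radialDensity n f v u| ≤ C := by
  rcases eq_or_ne u 0 with rfl | hu
  · rw [radialDensity_zero, abs_zero, mul_zero]
    exact (by positivity : 0 ≤ (1 + ‖(0 : Z)‖) ^ (n + 1) * |f 0|).trans (hC 0)
  · refine le_trans (le_of_eq ?_) (hC (u⁻¹ • v))
    have hu' : ‖u‖ ≠ 0 := norm_ne_zero_iff.2 hu
    rw [radialDensity, abs_mul, abs_pow, ← mul_assoc, ← mul_pow, norm_smul, hv, mul_one, norm_inv,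
      abs_inv, ← Real.norm_eq_abs u]
    congr 2
    field_simp
    ring

theorem abs_radialDensity_le (hC : ∀ z, (1 + ‖z‖) ^ (n + 1) * |f z| ≤ C) (hv : ‖v‖ = 1) (u : ℝ) :
    |radialDensity n f v u| ≤ C :=
  (le_mul_of_one_le_left (abs_nonneg _) (one_le_pow₀ (by simp))).trans
    (one_add_norm_pow_mul_abs_radialDensity_le hC hv u)

theorem integrable_radialDensity (hn : 0 < n) (hf : HasRadialDecay n f)
    (hC : ∀ z, (1 + ‖z‖) ^ (n + 1) * |f z| ≤ C) (hv : ‖v‖ = 1) :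
    Integrable (radialDensity n f v) :=
  integrable_of_one_add_norm_pow_mul_abs_le (continuous_radialDensity hf hv)
    (by rw [Module.finrank_self]; lia) (one_add_norm_pow_mul_abs_radialDensity_le hC hv)

theorem integral_Ioi_pow_mul_eq_integral_inv (hn : 0 < n) (g : ℝ → ℝ) :
    ∫ r in Ioi (0 : ℝ), r ^ (n - 1) * g r = ∫ u in Ioi (0 : ℝ), u⁻¹ ^ (n + 1) * g u⁻¹ := by
  rw [← integral_comp_rpow_Ioi _ (neg_ne_zero.2 (one_ne_zero (α := ℝ)))]
  refine setIntegral_congr_fun measurableSet_Ioi fun u (hu : 0 < u) => ?_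
  have hjac : u ^ ((-1 : ℝ) - 1) = u⁻¹ ^ 2 := by
    rw [inv_pow, ← Real.rpow_natCast, ← Real.rpow_neg hu.le]
    norm_num
  simp only [abs_neg, abs_one, one_mul, hjac, Real.rpow_neg_one, smul_eq_mul]
  rw [← mul_assoc, ← pow_add]
  congr 2
  lia

theorem hasDerivAt_integral_Ioi {g : ℝ → ℝ} (hg : Continuous g) (hint : Integrable g) (s : ℝ) :
    HasDerivAt (fun t => ∫ u in Ioi t, g u) (-g s) s := by
  have heq : (fun t => ∫ u in Ioi t, g u) = fun t => (∫ u in Ioi 0, g u) - ∫ u in (0 : ℝ)..t, g u :=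
    funext fun t => by
      rw [← intervalIntegral.integral_Ioi_sub_Ioi' hint.integrableOn hint.integrableOn,
        sub_sub_cancel]
  rw [heq]
  exact (hg.integral_hasStrictDerivAt 0 s).hasDerivAt.const_sub _

end RadialDecay

theorem hasFDerivAt_comp_of_hasDerivAt_zero {E : Type*} [NormedAddCommGroup E] [NormedSpace ℝ E]
    {ψ : ℝ → ℝ} {τ : E → ℝ} {p : E} (hψ : HasDerivAt ψ 0 (τ p))
    (hτ : (fun q => τ q - τ p) =O[𝓝 p] fun q => q - p) :
    HasFDerivAt (fun q => ψ (τ q)) (0 : E →L[ℝ] ℝ) p := by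
  have hτ_cont : Tendsto τ (𝓝 p) (𝓝 (τ p)) :=
    tendsto_sub_nhds_zero_iff.1 <| hτ.trans_tendsto (tendsto_sub_nhds_zero_iff.2 tendsto_id)
  refine .of_isLittleO (((hψ.hasFDerivAt.isLittleO.comp_tendsto hτ_cont).trans_isBigO
    hτ).congr_left fun q => ?_)
  simp

section RadialMass

variable {H Z : Type*} [NormedAddCommGroup Z] [NormedSpace ℝ Z]

/-- The mass which the density `f` puts on the part of the ray of `v` where `G (x, ·) ≤ 0`, in the
polar coordinates of an `n`-dimensional space. -/
noncomputable def radialMass (n : ℕ) (f : Z → ℝ) (G : H × Z → ℝ) (x : H) (v : Z) : ℝ :=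
  ∫ r in Ioi (0 : ℝ), r ^ (n - 1) * {z | G (x, z) ≤ 0}.indicator f (r • v)

variable [NormedAddCommGroup H] {n : ℕ} {f : Z → ℝ} {G : H × Z → ℝ} {x₀ x y : H} {v : Z}
  {δ C : ℝ}

namespace IsUniformSlater

theorem radialMass_eq (hG : IsUniformSlater G x₀ δ) (hx : x ∈ Metric.ball x₀ δ) (hn : 0 < n)
    (f : Z → ℝ) (v : Z) :
    radialMass n f G x v = ∫ u in Ioi (invRadius G x v), radialDensity n f v u := by
  set τ := invRadius G x v
  have hcut {u : ℝ} (hu : 0 < u) : u⁻¹ ^ (n + 1) * {z | G (x, z) ≤ 0}.indicator f (u⁻¹ • v) =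
      (Ici τ).indicator (radialDensity n f v) u := by
    simp only [indicator, mem_ofPred_eq, mem_Ici, ← hG.invRadius_le_iff hx hu, mul_ite, mul_zero,
      radialDensity, τ]
  rw [radialMass, integral_Ioi_pow_mul_eq_integral_inv hn,
    setIntegral_congr_fun measurableSet_Ioi fun u hu => hcut hu,
    setIntegral_indicator measurableSet_Ici, ← integral_Ici_eq_integral_Ioi,
    setIntegral_congr_set (t := Ici 0 ∩ Ici τ)
      (Ioi_ae_eq_Ici.inter (ae_eq_refl _)), Ici_inter_Ici, sup_eq_right.2 (invRadius_nonneg G x v)]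

theorem abs_radialMass_sub_le (hG : IsUniformSlater G x₀ δ) (hx : x ∈ Metric.ball x₀ δ)
    (hy : y ∈ Metric.ball x₀ δ) (hn : 0 < n) (hf : HasRadialDecay n f)
    (hC : ∀ z, (1 + ‖z‖) ^ (n + 1) * |f z| ≤ C) (hv : ‖v‖ = 1) :
    |radialMass n f G y v - radialMass n f G x v| ≤ C / (2 * δ ^ 2) * ‖y - x‖ := by
  have hint := integrable_radialDensity hn hf hC hv
  have hC0 : 0 ≤ C := (abs_nonneg _).trans (abs_radialDensity_le hC hv 0)
  calc |radialMass n f G y v - radialMass n f G x v|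
      = |∫ u in invRadius G y v..invRadius G x v, radialDensity n f v u| := by
        rw [hG.radialMass_eq hx hn, hG.radialMass_eq hy hn,
          intervalIntegral.integral_Ioi_sub_Ioi' hint.integrableOn hint.integrableOn]
    _ ≤ C * |invRadius G x v - invRadius G y v| :=
        intervalIntegral.norm_integral_le_of_norm_le_const (f := radialDensity n f v)
          fun u _ => abs_radialDensity_le hC hv u
    _ ≤ C * (‖v‖ / (2 * δ ^ 2) * ‖x - y‖) := by
        gcongr
        exact hG.abs_invRadius_sub_le hy hx
    _ = C / (2 * δ ^ 2) * ‖y - x‖ := by rw [hv, norm_sub_rev]; ring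

end IsUniformSlater

variable [NormedSpace ℝ H]

/-- The derivative of `x ↦ radialMass n f G x v`, under the assumptions under which
`invRadiusDeriv G x v` is meaningful, and also if `invRadius G x v = 0`, when it vanishes. -/
noncomputable def radialMassDeriv (n : ℕ) (f : Z → ℝ) (G : H × Z → ℝ) (x : H) (v : Z) :
    H →L[ℝ] ℝ :=
  -radialDensity n f v (invRadius G x v) • invRadiusDeriv G x v

theorem radialMassDeriv_eq_zero (hτ : invRadius G x v = 0) : radialMassDeriv n f G x v = 0 := by
  rw [radialMassDeriv, hτ, radialDensity_zero, neg_zero, zero_smul]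

namespace IsUniformSlater

theorem hasFDerivAt_radialMass (hG : IsUniformSlater G x₀ δ) (hx : x ∈ Metric.ball x₀ δ)
    (hn : 0 < n) (hf : HasRadialDecay n f) (hC : ∀ z, (1 + ‖z‖) ^ (n + 1) * |f z| ≤ C)
    (hv : ‖v‖ = 1)
    (hd : 0 < invRadius G x v → DifferentiableAt ℝ G (x, (invRadius G x v)⁻¹ • v)) :
    HasFDerivAt (fun y => radialMass n f G y v) (radialMassDeriv n f G x v) x := by
  have hψ := hasDerivAt_integral_Ioi (continuous_radialDensity hf hv)
    (integrable_radialDensity hn hf hC hv) (invRadius G x v)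
  refine HasFDerivAt.congr_of_eventuallyEq
    (f := fun y => ∫ u in Ioi (invRadius G y v), radialDensity n f v u) ?_ ?_
  · rcases (invRadius_nonneg G x v).eq_or_lt' with hτ | hτ
    · rw [radialMassDeriv_eq_zero hτ]
      refine hasFDerivAt_comp_of_hasDerivAt_zero
        (ψ := fun t => ∫ u in Ioi t, radialDensity n f v u) ?_ (hG.isBigO_invRadius_sub hx v)
      simpa [hτ, radialDensity_zero] using hψ
    · exact hψ.comp_hasFDerivAt x (hG.hasFDerivAt_invRadius hx hτ (hd hτ))
  · filter_upwards [Metric.isOpen_ball.mem_nhds hx] with y hy using hG.radialMass_eq hy hn f v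

theorem norm_radialMassDeriv_le (hG : IsUniformSlater G x₀ δ) (hx : x ∈ Metric.ball x₀ δ)
    (hv : ‖v‖ = 1)
    (hd : 0 < invRadius G x v → DifferentiableAt ℝ G (x, (invRadius G x v)⁻¹ • v)) :
    ‖radialMassDeriv n f G x v‖ ≤
      |radialDensity n f v (invRadius G x v)| * (1 / (2 * δ ^ 2)) := by
  rcases (invRadius_nonneg G x v).eq_or_lt' with hτ | hτ
  · rw [radialMassDeriv_eq_zero hτ, norm_zero]
    positivity
  · rw [radialMassDeriv, norm_smul, norm_neg, Real.norm_eq_abs, ← hv]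
    gcongr
    exact hG.norm_invRadiusDeriv_le hx hτ (hd hτ)

theorem tendsto_radialMassDeriv {ι : Type*} {l : Filter ι} {Gk : ι → H × Z → ℝ} {xk : ι → H}
    (hG : IsUniformSlater G x₀ δ) (hGk : ∀ᶠ k in l, IsUniformSlater (Gk k) x₀ δ)
    (hxk : Tendsto xk l (𝓝 x₀)) (hf : HasRadialDecay n f) (hv : ‖v‖ = 1)
    (hdk : ∀ᶠ k in l, Differentiable ℝ (Gk k))
    (hd : 0 < invRadius G x₀ v → DifferentiableAt ℝ G (x₀, (invRadius G x₀ v)⁻¹ • v))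
    (hτk : Tendsto (fun k => invRadius (Gk k) (xk k) v) l (𝓝 (invRadius G x₀ v)))
    (hfderiv : 0 < invRadius G x₀ v →
      Tendsto (fun k => fderiv ℝ (Gk k) (xk k, (invRadius (Gk k) (xk k) v)⁻¹ • v)) l
        (𝓝 (fderiv ℝ G (x₀, (invRadius G x₀ v)⁻¹ • v)))) :
    Tendsto (fun k => radialMassDeriv n f (Gk k) (xk k) v) l (𝓝 (radialMassDeriv n f G x₀ v)) := by
  have hdens := ((continuous_radialDensity hf hv).tendsto _).comp hτk
  rcases (invRadius_nonneg G x₀ v).eq_or_lt' with hτ | hτ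
  · rw [radialMassDeriv_eq_zero hτ]
    rw [hτ, radialDensity_zero] at hdens
    have hbound := hdens.abs.mul_const (1 / (2 * δ ^ 2))
    rw [abs_zero, zero_mul] at hbound
    refine squeeze_zero_norm' ?_ hbound
    filter_upwards [hGk, hdk, hxk (Metric.ball_mem_nhds x₀ hG.pos)] with k hGk hdk hxk
    exact hGk.norm_radialMassDeriv_le hxk hv fun _ => hdk _
  · exact hdens.neg.smul (hG.tendsto_invRadiusDeriv hτ (hd hτ) hτk (hfderiv hτ))

end IsUniformSlater

end RadialMass

section Polar

theorem integral_volumeIoiPow {F : Type*} [NormedAddCommGroup F] [NormedSpace ℝ F] (k : ℕ)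
    (g : ℝ → F) :
    ∫ r : Ioi (0 : ℝ), g r ∂Measure.volumeIoiPow k = ∫ r in Ioi (0 : ℝ), r ^ k • g r := by
  simp only [Measure.volumeIoiPow, ENNReal.ofReal]
  rw [integral_withDensity_eq_integral_smul ((measurable_subtype_coe.pow_const _).real_toNNReal),
    integral_subtype_comap measurableSet_Ioi fun r : ℝ => Real.toNNReal (r ^ k) • g r]
  refine setIntegral_congr_fun measurableSet_Ioi fun r (hr : 0 < r) => ?_
  simp only [NNReal.smul_def, Real.coe_toNNReal _ (pow_nonneg hr.le k)]

variable {Z F : Type*} [NormedAddCommGroup Z] [NormedSpace ℝ Z]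

theorem homeomorphUnitSphereProd_snd_smul_fst (z : ({0}ᶜ : Set Z)) :
    (homeomorphUnitSphereProd Z z).2.1 • (homeomorphUnitSphereProd Z z).1.1 = (z : Z) := by
  rw [← homeomorphUnitSphereProd_symm_apply_coe, Homeomorph.symm_apply_apply]

variable [FiniteDimensional ℝ Z] [MeasurableSpace Z] [BorelSpace Z] [NormedAddCommGroup F]
  (μ : Measure Z) [μ.IsAddHaarMeasure] {g : Z → F}

theorem integrable_polar (hg : Integrable g μ) :
    Integrable (fun q : Metric.sphere (0 : Z) 1 × Ioi (0 : ℝ) => g (q.2.1 • q.1.1))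
      (μ.toSphere.prod (Measure.volumeIoiPow (Module.finrank ℝ Z - 1))) := by
  rw [← μ.measurePreserving_homeomorphUnitSphereProd.integrable_comp_emb
    (homeomorphUnitSphereProd Z).measurableEmbedding]
  simp only [Function.comp_def, homeomorphUnitSphereProd_snd_smul_fst]
  exact (integrableOn_iff_comap_subtypeVal (measurableSet_singleton _).compl).1 hg.integrableOn

variable [NormedSpace ℝ F]

theorem integrable_integral_Ioi_smul (hg : Integrable g μ) :
    Integrable (fun v : Metric.sphere (0 : Z) 1 =>
      ∫ r in Ioi (0 : ℝ), r ^ (Module.finrank ℝ Z - 1) • g (r • (v : Z))) μ.toSphere :=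
  (integrable_polar μ hg).integral_prod_left.congr
    (ae_of_all _ fun v => integral_volumeIoiPow _ fun r => g (r • (v : Z)))

theorem integral_eq_integral_sphere_integral_Ioi [Nontrivial Z] (hg : Integrable g μ) :
    ∫ z, g z ∂μ = ∫ v : Metric.sphere (0 : Z) 1,
      (∫ r in Ioi (0 : ℝ), r ^ (Module.finrank ℝ Z - 1) • g (r • (v : Z))) ∂μ.toSphere := by
  calc ∫ z, g z ∂μ = ∫ z : ({0}ᶜ : Set Z), g z ∂(μ.comap (↑)) := by
        rw [integral_subtype_comap (measurableSet_singleton _).compl g, restrict_compl_singleton]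
    _ = ∫ q : Metric.sphere (0 : Z) 1 × Ioi (0 : ℝ), g (q.2.1 • q.1.1)
          ∂(μ.toSphere.prod (Measure.volumeIoiPow (Module.finrank ℝ Z - 1))) := by
        rw [← μ.measurePreserving_homeomorphUnitSphereProd.integral_comp
          (homeomorphUnitSphereProd Z).measurableEmbedding]
        simp only [homeomorphUnitSphereProd_snd_smul_fst]
    _ = _ := by
        rw [integral_prod _ (integrable_polar μ hg)]
        exact integral_congr_ae
          (ae_of_all _ fun v => integral_volumeIoiPow _ fun r => g (r • (v : Z)))

theorem integral_eq_integral_abs_det_smul_comp (L : Z ≃L[ℝ] Z) (g : Z → F) :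
    ∫ z, g z ∂μ = ∫ z, |(L : Z →L[ℝ] Z).det| • g (L z) ∂μ := by
  have h := integral_image_eq_integral_abs_det_fderiv_smul μ MeasurableSet.univ
    (fun z _ => (L.hasFDerivAt (x := z)).hasFDerivWithinAt) L.injective.injOn g
  rwa [image_univ, L.surjective.range_eq, Measure.restrict_univ] at h

end Polar

section FDerivMeasurable

variable {α H F : Type*} [MeasurableSpace α] {μ : Measure α} [NormedAddCommGroup H]
  [NormedSpace ℝ H] [NormedAddCommGroup F] [NormedSpace ℝ F] {f : H → α → F}
  {f' : α → H →L[ℝ] F} {x : H} {s : Set H}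

theorem aestronglyMeasurable_apply_of_hasFDerivAt (hs : s ∈ 𝓝 x)
    (hf : ∀ y ∈ s, AEStronglyMeasurable (f y) μ)
    (hd : ∀ᵐ a ∂μ, HasFDerivAt (fun y => f y a) (f' a) x) (e : H) :
    AEStronglyMeasurable (fun a => f' a e) μ := by
  have hstep : Tendsto (fun c : ℝ => x + c⁻¹ • e) atTop (𝓝 x) := by
    simpa using (tendsto_inv_atTop_zero (𝕜 := ℝ)).smul_const e |>.const_add x
  obtain ⟨R, hR⟩ := eventually_atTop.1 (hstep hs)
  refine aestronglyMeasurable_of_tendsto_ae (atTop : Filter ℕ)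
    (f := fun k a => (R + k) • (f (x + (R + k)⁻¹ • e) a - f x a)) (fun k => ?_) ?_
  · exact ((hf _ (hR _ (by simp))).sub (hf x (mem_of_mem_nhds hs))).const_smul _
  · filter_upwards [hd] with a ha
    exact (ha.lim_real e).comp (tendsto_atTop_add_const_left _ R tendsto_natCast_atTop_atTop)

theorem aestronglyMeasurable_of_hasFDerivAt [FiniteDimensional ℝ H] (hs : s ∈ 𝓝 x)
    (hf : ∀ y ∈ s, AEStronglyMeasurable (f y) μ)
    (hd : ∀ᵐ a ∂μ, HasFDerivAt (fun y => f y a) (f' a) x) : AEStronglyMeasurable f' μ := by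
  let b := Module.finBasis ℝ H
  have hsum : f' = fun a => ∑ i, (b.coord i).toContinuousLinearMap.smulRight (f' a (b i)) := by
    ext a y
    conv_lhs => rw [← b.sum_repr y]
    simp only [map_sum, map_smul, sum_apply, ContinuousLinearMap.smulRight_apply,
      LinearMap.coe_toContinuousLinearMap', Module.Basis.coord_apply]
  rw [hsum]
  exact Finset.aestronglyMeasurable_fun_sum _ fun i _ =>
    (ContinuousLinearMap.smulRightL ℝ H F (b.coord i).toContinuousLinearMap).continuous
      |>.comp_aestronglyMeasurable (aestronglyMeasurable_apply_of_hasFDerivAt hs hf hd (b i))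

end FDerivMeasurable

section FeasibleMass

variable {H Z : Type*} [NormedAddCommGroup Z] [NormedSpace ℝ Z] [MeasurableSpace Z]

/-- The mass, with respect to the density `f`, of the set of those `z` with `G (x, z) ≤ 0`. The
probability function and its regularizations are of this form. -/
noncomputable def feasibleMass (μ : Measure Z) (f : Z → ℝ) (G : H × Z → ℝ) (x : H) : ℝ :=
  ∫ z in {z | G (x, z) ≤ 0}, f z ∂μ

variable [NormedAddCommGroup H] [FiniteDimensional ℝ Z] [BorelSpace Z] {μ : Measure Z}
  [μ.IsAddHaarMeasure] {f : Z → ℝ} {G : H × Z → ℝ} {x₀ x y : H} {δ C : ℝ}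

namespace IsUniformSlater

theorem measurableSet_feasible (hG : IsUniformSlater G x₀ δ) (hx : x ∈ Metric.ball x₀ δ) :
    MeasurableSet {z | G (x, z) ≤ 0} :=
  (isClosed_le (hG.convexOn x hx).locallyLipschitz.continuous continuous_const).measurableSet

theorem integrable_radialMass (hG : IsUniformSlater G x₀ δ) (hx : x ∈ Metric.ball x₀ δ)
    (hf : Integrable f μ) :
    Integrable (fun v : Metric.sphere (0 : Z) 1 => radialMass (Module.finrank ℝ Z) f G x v)
      μ.toSphere :=
  integrable_integral_Ioi_smul μ (hf.indicator (hG.measurableSet_feasible hx))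

variable [Nontrivial Z]

theorem feasibleMass_eq (hG : IsUniformSlater G x₀ δ) (hx : x ∈ Metric.ball x₀ δ)
    (hf : Integrable f μ) :
    feasibleMass μ f G x = ∫ v : Metric.sphere (0 : Z) 1,
      radialMass (Module.finrank ℝ Z) f G x v ∂μ.toSphere := by
  have hfeas := hG.measurableSet_feasible hx
  rw [feasibleMass, ← integral_indicator hfeas,
    integral_eq_integral_sphere_integral_Ioi μ (hf.indicator hfeas)]
  rfl

theorem exists_lipschitzOnWith_feasibleMass (hG : IsUniformSlater G x₀ δ)
    (hf : HasRadialDecay (Module.finrank ℝ Z) f) :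
    ∃ κ : ℝ≥0, LipschitzOnWith κ (feasibleMass μ f G) (Metric.ball x₀ δ) := by
  obtain ⟨C, hC⟩ := hf.exists_bound
  refine ⟨(C / (2 * δ ^ 2) * μ.toSphere.real univ).toNNReal,
    LipschitzOnWith.of_dist_le_mul fun y hy x hx => ?_⟩
  have hf_int : Integrable f μ := hf.integrable
  rw [dist_eq_norm, dist_eq_norm, hG.feasibleMass_eq hx hf_int, hG.feasibleMass_eq hy hf_int,
    ← integral_sub (hG.integrable_radialMass hy hf_int) (hG.integrable_radialMass hx hf_int)]
  calc _ ≤ C / (2 * δ ^ 2) * ‖y - x‖ * μ.toSphere.real univ :=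
        norm_integral_le_of_norm_le_const <| ae_of_all _ fun v =>
          hG.abs_radialMass_sub_le hx hy Module.finrank_pos hf hC (norm_eq_of_mem_sphere v)
    _ = C / (2 * δ ^ 2) * μ.toSphere.real univ * ‖y - x‖ := by ring
    _ ≤ _ := by gcongr; exact Real.le_coe_toNNReal _

variable [NormedSpace ℝ H] [FiniteDimensional ℝ H]

theorem hasFDerivAt_feasibleMass (hG : IsUniformSlater G x₀ δ) (hx : x ∈ Metric.ball x₀ δ)
    (hf : HasRadialDecay (Module.finrank ℝ Z) f)
    (hd : ∀ᵐ v : Metric.sphere (0 : Z) 1 ∂μ.toSphere, 0 < invRadius G x (v : Z) →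
      DifferentiableAt ℝ G (x, (invRadius G x (v : Z))⁻¹ • (v : Z))) :
    Integrable (fun v : Metric.sphere (0 : Z) 1 => radialMassDeriv (Module.finrank ℝ Z) f G x v)
      μ.toSphere ∧
    HasFDerivAt (feasibleMass μ f G) (∫ v : Metric.sphere (0 : Z) 1,
      radialMassDeriv (Module.finrank ℝ Z) f G x v ∂μ.toSphere) x := by
  obtain ⟨C, hC⟩ := hf.exists_bound
  have hball : Metric.ball x₀ δ ∈ 𝓝 x := Metric.isOpen_ball.mem_nhds hx
  have hmeas : ∀ y ∈ Metric.ball x₀ δ, AEStronglyMeasurable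
      (fun v : Metric.sphere (0 : Z) 1 => radialMass (Module.finrank ℝ Z) f G y v) μ.toSphere :=
    fun y hy => (hG.integrable_radialMass hy hf.integrable).aestronglyMeasurable
  have hderiv : ∀ᵐ v : Metric.sphere (0 : Z) 1 ∂μ.toSphere,
      HasFDerivAt (fun y => radialMass (Module.finrank ℝ Z) f G y (v : Z))
        (radialMassDeriv (Module.finrank ℝ Z) f G x v) x := by
    filter_upwards [hd] with v hv using hG.hasFDerivAt_radialMass hx Module.finrank_pos hf hC
      (norm_eq_of_mem_sphere v) hv
  refine (hasFDerivAt_integral_of_dominated_loc_of_lip' (bound := fun _ => C / (2 * δ ^ 2)) hball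
    hmeas (hG.integrable_radialMass hx hf.integrable)
    (aestronglyMeasurable_of_hasFDerivAt hball hmeas hderiv) (ae_of_all _ fun v y hy =>
      hG.abs_radialMass_sub_le hx hy Module.finrank_pos hf hC (norm_eq_of_mem_sphere v))
    (integrable_const _) hderiv).imp_right fun h => h.congr_of_eventuallyEq ?_
  filter_upwards [hball] with y hy using hG.feasibleMass_eq hy hf.integrable

theorem tendsto_fderiv_feasibleMass {ι : Type*} {l : Filter ι} [l.IsCountablyGenerated]
    {Gk : ι → H × Z → ℝ} {xk : ι → H} (hG : IsUniformSlater G x₀ δ)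
    (hGk : ∀ᶠ k in l, IsUniformSlater (Gk k) x₀ δ) (hxk : Tendsto xk l (𝓝 x₀))
    (hf : HasRadialDecay (Module.finrank ℝ Z) f) (hdk : ∀ᶠ k in l, Differentiable ℝ (Gk k))
    (hd : ∀ᵐ v : Metric.sphere (0 : Z) 1 ∂μ.toSphere, 0 < invRadius G x₀ (v : Z) →
      DifferentiableAt ℝ G (x₀, (invRadius G x₀ (v : Z))⁻¹ • (v : Z)))
    (hlim : ∀ p pk, Tendsto pk l (𝓝 p) → Tendsto (fun k => Gk k (pk k)) l (𝓝 (G p)))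
    (hfderiv : ∀ p pk, DifferentiableAt ℝ G p → Tendsto pk l (𝓝 p) →
      Tendsto (fun k => fderiv ℝ (Gk k) (pk k)) l (𝓝 (fderiv ℝ G p))) :
    Tendsto (fun k => fderiv ℝ (feasibleMass μ f (Gk k)) (xk k)) l
      (𝓝 (fderiv ℝ (feasibleMass μ f G) x₀)) := by
  obtain ⟨C, hC⟩ := hf.exists_bound
  have hxk_mem : ∀ᶠ k in l, xk k ∈ Metric.ball x₀ δ := hxk (Metric.ball_mem_nhds x₀ hG.pos)
  have hderiv_k : ∀ᶠ k in l, Integrable (fun v : Metric.sphere (0 : Z) 1 =>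
      radialMassDeriv (Module.finrank ℝ Z) f (Gk k) (xk k) v) μ.toSphere ∧
      HasFDerivAt (feasibleMass μ f (Gk k)) (∫ v : Metric.sphere (0 : Z) 1,
        radialMassDeriv (Module.finrank ℝ Z) f (Gk k) (xk k) v ∂μ.toSphere) (xk k) := by
    filter_upwards [hGk, hxk_mem, hdk] with k hGk hxk hdk
      using hGk.hasFDerivAt_feasibleMass hxk hf (ae_of_all _ fun v _ => hdk _)
  rw [(hG.hasFDerivAt_feasibleMass (Metric.mem_ball_self hG.pos) hf hd).2.fderiv]
  refine (tendsto_integral_filter_of_dominated_convergence (fun _ => C * (1 / (2 * δ ^ 2)))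
    ?_ ?_ (integrable_const _) ?_).congr' (hderiv_k.mono fun k hk => hk.2.fderiv.symm)
  · filter_upwards [hderiv_k] with k hk using hk.1.aestronglyMeasurable
  · filter_upwards [hGk, hxk_mem, hdk] with k hGk hxk hdk
    refine ae_of_all _ fun v => ?_
    have hv : ‖(v : Z)‖ = 1 := norm_eq_of_mem_sphere v
    refine (hGk.norm_radialMassDeriv_le hxk hv fun _ => hdk _).trans ?_
    gcongr
    exact abs_radialDensity_le hC hv _
  · filter_upwards [hd] with v hv
    have hτk := hG.tendsto_invRadius hGk hxk
      (fun z => hlim _ _ (hxk.prodMk_nhds tendsto_const_nhds)) (v : Z)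
    exact hG.tendsto_radialMassDeriv hGk hxk hf (norm_eq_of_mem_sphere v) hdk hv hτk fun hτ =>
      hfderiv _ _ (hv hτ) (hxk.prodMk_nhds ((hτk.inv₀ hτ.ne').smul_const _))

end IsUniformSlater

end FeasibleMass

section SupFun

variable {H Y : Type*} [NormedAddCommGroup Y] [NormedSpace ℝ Y] {m : ℕ}
  {C : Set (WeakDual ℝ Y)} {K : ProperCone ℝ Y} {Φ : H → Rm m → Y} {h : H → ℝ}

theorem isLUB_supFun (hC_ne : C.Nonempty) (hC : IsCompact C) (p : WithLp 2 (H × Rm m)) :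
    IsLUB ((fun w : WeakDual ℝ Y => w (Φ p.fst p.snd) + h p.fst) '' C) (supFun C Φ h p) :=
  isLUB_csSup (hC_ne.image _)
    (hC.image ((WeakDual.eval_continuous _).add continuous_const)).bddAbove

theorem supFun_le_self_iff [NormedAddCommGroup H] (hC_ne : C.Nonempty)
    (hC : IsCompact C) {x : H} {z : Rm m} :
    supFun C Φ h (pt x z) ≤ h x ↔ ∀ w ∈ C, w (Φ x z) ≤ 0 := by
  rw [isLUB_le_iff (isLUB_supFun hC_ne hC _), mem_upperBounds, forall_mem_image]
  exact forall₂_congr fun w _ => add_le_iff_nonpos_left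

theorem GeneratesPolar.neg_mem_iff (hgen : GeneratesPolar C K) {y : Y} :
    -y ∈ K ↔ ∀ w ∈ C, w y ≤ 0 := by
  refine ⟨fun hy w hw => ?_, fun hy => ?_⟩
  · have hpolar : w ∈ {w : WeakDual ℝ Y | ∀ y ∈ K, 0 ≤ w y} :=
      hgen ▸ subset_closure ⟨1, zero_le_one, w, hw, (one_smul ℝ w).symm⟩
    simpa using hpolar _ hy
  · by_contra hmem
    obtain ⟨g, hg_polar, hg_neg⟩ := K.hyperplane_separation_point hmem
    have hg_closure : StrongDual.toWeakDual g ∈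
        closure {w : WeakDual ℝ Y | ∃ t : ℝ, 0 ≤ t ∧ ∃ c ∈ C, w = t • c} := by
      rw [show closure _ = _ from hgen]
      exact hg_polar
    have hcone : {w : WeakDual ℝ Y | ∃ t : ℝ, 0 ≤ t ∧ ∃ c ∈ C, w = t • c} ⊆ {w | w y ≤ 0} := by
      rintro _ ⟨t, ht, c, hc, rfl⟩
      exact mul_nonpos_of_nonneg_of_nonpos ht (hy c hc)
    have hg_nonpos : g y ≤ 0 := closure_minimal hcone
      (isClosed_le (WeakDual.eval_continuous y) continuous_const) hg_closure
    rw [map_neg] at hg_neg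
    linarith

theorem convexOn_supFun [NormedAddCommGroup H] [NormedSpace ℝ H] (hC_ne : C.Nonempty)
    (hC : IsCompact C)
    (hΦ : ∀ w ∈ C, ConvexOn ℝ univ (fun p : H × Rm m => w (Φ p.1 p.2) + h p.1)) :
    ConvexOn ℝ univ (supFun C Φ h) := by
  refine ⟨convex_univ, fun p _ q _ a b ha hb hab => ?_⟩
  refine (isLUB_le_iff (isLUB_supFun hC_ne hC _)).2 (forall_mem_image.2 fun w hw => ?_)
  have hle (p : WithLp 2 (H × Rm m)) : w (Φ p.fst p.snd) + h p.fst ≤ supFun C Φ h p :=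
    (isLUB_supFun hC_ne hC p).1 (mem_image_of_mem _ hw)
  calc w (Φ (a • p + b • q).fst (a • p + b • q).snd) + h (a • p + b • q).fst
      ≤ a * (w (Φ p.fst p.snd) + h p.fst) + b * (w (Φ q.fst q.snd) + h q.fst) :=
        (hΦ w hw).2 (mem_univ (p.fst, p.snd)) (mem_univ (q.fst, q.snd)) ha hb hab
    _ ≤ a * supFun C Φ h p + b * supFun C Φ h q := by gcongr <;> exact hle _

end SupFun

section Coordinates

variable {m : ℕ} {L : Matrix (Fin m) (Fin m) ℝ}

theorem det_toEuclideanLin (L : Matrix (Fin m) (Fin m) ℝ) :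
    LinearMap.det (Matrix.toEuclideanLin L) = L.det := by
  rw [Matrix.toEuclideanLin_eq_toLin_orthonormal, LinearMap.det_toLin]

/-- The nonsingular matrix `L` as a linear isomorphism of `ℝ^m`. -/
noncomputable def matrixEquiv (hL : L.det ≠ 0) : Rm m ≃L[ℝ] Rm m :=
  (LinearMap.equivOfDetNeZero (Matrix.toEuclideanLin L)
    (by rwa [det_toEuclideanLin])).toContinuousLinearEquiv

theorem det_matrixEquiv (hL : L.det ≠ 0) :
    (matrixEquiv hL : Rm m →L[ℝ] Rm m).det = L.det :=
  det_toEuclideanLin L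

variable {H : Type*} [NormedAddCommGroup H] [InnerProductSpace ℝ H]

/-- The change of variables `(x, z) ↦ (x, L z)`, from the product with the supremum norm to the
Hilbert product. -/
noncomputable def ptEquiv (H : Type*) [NormedAddCommGroup H] [InnerProductSpace ℝ H]
    (hL : L.det ≠ 0) : (H × Rm m) ≃L[ℝ] WithLp 2 (H × Rm m) :=
  ((ContinuousLinearEquiv.refl ℝ H).prodCongr (matrixEquiv hL)).trans
    (WithLp.prodContinuousLinearEquiv 2 ℝ H (Rm m)).symm

/-- The constraint function `T - h` in the variables `(x, z)` with `ξ = L z`. -/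
noncomputable def excess (T : WithLp 2 (H × Rm m) → ℝ) (h : H → ℝ)
    (L : Matrix (Fin m) (Fin m) ℝ) (p : H × Rm m) : ℝ :=
  T (pt p.1 (Matrix.toEuclideanLin L p.2)) - h p.1

/-- The density at `z` of `L⁻¹ ξ` if `f` is the density of `ξ`. -/
noncomputable def pullbackDensity (L : Matrix (Fin m) (Fin m) ℝ) (f : Rm m → ℝ) (z : Rm m) : ℝ :=
  |L.det| * f (Matrix.toEuclideanLin L z)

theorem HasRadialDecay.pullbackDensity {n : ℕ} {f : Rm m → ℝ} (hf : HasRadialDecay n f)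
    (hL : L.det ≠ 0) : HasRadialDecay n (pullbackDensity L f) :=
  (hf.comp_continuousLinearEquiv (matrixEquiv hL)).const_mul |L.det|

variable {T S : WithLp 2 (H × Rm m) → ℝ} {h : H → ℝ} {x₀ : H}

theorem toEuclideanLin_smul_eq_ray (r : ℝ) (v : Sph m) :
    Matrix.toEuclideanLin L (r • (v : Rm m)) = ray L r v :=
  map_smul _ _ _

theorem differentiableAt_of_differentiableAt_excess (hL : L.det ≠ 0) {p : H × Rm m}
    (hT : DifferentiableAt ℝ (excess T h L) p) (hh : DifferentiableAt ℝ h p.1) :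
    DifferentiableAt ℝ T (ptEquiv H hL p) := by
  refine (ptEquiv H hL).comp_right_differentiableAt_iff.1 ?_
  refine (hT.add (hh.comp p differentiableAt_fst)).congr_of_eventuallyEq (.of_forall fun q => ?_)
  exact (sub_add_cancel _ _).symm

theorem hasFDerivAt_excess (hL : L.det ≠ 0) {p : H × Rm m}
    (hT : DifferentiableAt ℝ T (ptEquiv H hL p)) (hh : DifferentiableAt ℝ h p.1) :
    HasFDerivAt (excess T h L)
      (fderiv ℝ T (ptEquiv H hL p) ∘L (ptEquiv H hL : H × Rm m →L[ℝ] WithLp 2 (H × Rm m)) -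
        fderiv ℝ h p.1 ∘L ContinuousLinearMap.fst ℝ H (Rm m)) p :=
  (hT.hasFDerivAt.comp p (ptEquiv H hL).hasFDerivAt).sub (hh.hasFDerivAt.comp p hasFDerivAt_fst)

theorem differentiable_excess (hL : L.det ≠ 0) (hT : Differentiable ℝ T)
    (hh : Differentiable ℝ h) : Differentiable ℝ (excess T h L) := fun p =>
  (hasFDerivAt_excess hL (hT _) (hh p.1)).differentiableAt

theorem exists_isUniformSlater_excess [FiniteDimensional ℝ H] (hL : L.det ≠ 0)
    (hS : ContinuousAt S (pt x₀ 0)) (hh : ContDiffAt ℝ 1 h x₀) (hsl : S (pt x₀ 0) < h x₀) :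
    ∃ δ, ∀ T, ConvexOn ℝ univ T → T ≤ S → IsUniformSlater (excess T h L) x₀ δ := by
  have hzero : ptEquiv H hL (x₀, 0) = pt x₀ 0 := congrArg (pt x₀) (map_zero (matrixEquiv hL))
  rw [← hzero] at hS hsl
  obtain ⟨κ, hlip⟩ := hh.exists_lipschitzOnWith
  obtain ⟨δ, hδ⟩ := exists_isUniformSlater_sub_comp_fst
    (hS.comp (f := ptEquiv H hL) (ptEquiv H hL).continuous.continuousAt) hlip hsl
  exact ⟨δ, fun T hT hTS =>
    hδ (T ∘ ptEquiv H hL) (hT.comp_linearMap (ptEquiv H hL).toLinearMap) fun _ => hTS _⟩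

end Coordinates

section MoreauExcess

variable {m : ℕ} {L : Matrix (Fin m) (Fin m) ℝ}
  {H : Type*} [NormedAddCommGroup H] [InnerProductSpace ℝ H] [FiniteDimensional ℝ H]
  {S : WithLp 2 (H × Rm m) → ℝ} {h : H → ℝ} {ι : Type*} {l : Filter ι} {lam : ι → ℝ}
  {p : H × Rm m} {pk : ι → H × Rm m}

theorem tendsto_excess_moreau (hL : L.det ≠ 0) (hS : ConvexOn ℝ univ S) (hh : Continuous h)
    (hpos : ∀ᶠ k in l, 0 < lam k) (hlam : Tendsto lam l (𝓝 0)) (hpk : Tendsto pk l (𝓝 p)) :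
    Tendsto (fun k => excess (moreau S (lam k)) h L (pk k)) l (𝓝 (excess S h L p)) := by
  have hScont := hS.locallyLipschitz.continuous
  obtain ⟨s, hs⟩ := subdiff_nonempty hS hScont (ptEquiv H hL p)
  exact (tendsto_moreau hs hScont.continuousAt hpos hlam
    (((ptEquiv H hL).continuous.tendsto p).comp hpk)).sub
    (((hh.comp continuous_fst).tendsto p).comp hpk)

theorem tendsto_fderiv_excess_moreau (hL : L.det ≠ 0) (hS : ConvexOn ℝ univ S)
    (hh : ContDiff ℝ 1 h) (hpos : ∀ᶠ k in l, 0 < lam k) (hlam : Tendsto lam l (𝓝 0))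
    (hd : DifferentiableAt ℝ (excess S h L) p) (hpk : Tendsto pk l (𝓝 p)) :
    Tendsto (fun k => fderiv ℝ (excess (moreau S (lam k)) h L) (pk k)) l
      (𝓝 (fderiv ℝ (excess S h L) p)) := by
  have hScont := hS.locallyLipschitz.continuous
  have hhd : Differentiable ℝ h := hh.differentiable one_ne_zero
  obtain ⟨s, hs⟩ := subdiff_nonempty hS hScont (ptEquiv H hL p)
  have hSd := differentiableAt_of_differentiableAt_excess hL hd (hhd p.1)
  have hpk' : Tendsto (fun k => ptEquiv H hL (pk k)) l (𝓝 (ptEquiv H hL p)) :=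
    ((ptEquiv H hL).continuous.tendsto p).comp hpk
  have hmoreau : Tendsto (fun k => fderiv ℝ (moreau S (lam k)) (ptEquiv H hL (pk k))) l
      (𝓝 (fderiv ℝ S (ptEquiv H hL p))) :=
    tendsto_fderiv_of_convexOn_minorants hS hSd (hpos.mono fun _ => convexOn_moreau hS)
      (hpos.mono fun _ hk => differentiable_moreau hS hk _)
      (hpos.mono fun _ => moreau_le_self hs) hpk'
      (tendsto_moreau hs hScont.continuousAt hpos hlam hpk')
  have hfst : Tendsto (fun k => fderiv ℝ h (pk k).1) l (𝓝 (fderiv ℝ h p.1)) :=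
    (((hh.continuous_fderiv one_ne_zero).comp continuous_fst).tendsto p).comp hpk
  rw [(hasFDerivAt_excess hL hSd (hhd p.1)).fderiv]
  refine (((continuous_id.clm_comp continuous_const).tendsto _ |>.comp hmoreau).sub
    ((continuous_id.clm_comp continuous_const).tendsto _ |>.comp hfst)).congr' ?_
  filter_upwards [hpos] with k hk
  exact (hasFDerivAt_excess hL (differentiable_moreau hS hk _) (hhd _)).fderiv.symm

end MoreauExcess

section Boundary

variable {m : ℕ} {L : Matrix (Fin m) (Fin m) ℝ} {H : Type*} [NormedAddCommGroup H]
  {T : WithLp 2 (H × Rm m) → ℝ} {h : H → ℝ} {x x₀ : H} {δ : ℝ} {v : Sph m}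

theorem IsUniformSlater.mem_finDir (hT : IsUniformSlater (excess T h L) x₀ δ)
    (hx : x ∈ Metric.ball x₀ δ) (hpos : 0 < invRadius (excess T h L) x v) :
    v ∈ finDir T h L x :=
  ⟨_, inv_pos.2 hpos, by
    rw [← toEuclideanLin_smul_eq_ray]
    exact sub_eq_zero.1 (hT.apply_eq_zero_of_invRadius_pos hx hpos)⟩

theorem IsUniformSlater.rho_eq_inv_invRadius (hT : IsUniformSlater (excess T h L) x₀ δ)
    (hx : x ∈ Metric.ball x₀ δ) (hpos : 0 < invRadius (excess T h L) x v) :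
    rho T h L x v = (invRadius (excess T h L) x v)⁻¹ := by
  have hmem {r : ℝ} (hr : 0 < r) :
      T (pt x (ray L r v)) ≤ h x ↔ r ≤ (invRadius (excess T h L) x v)⁻¹ := by
    rw [le_inv_comm₀ hr hpos, hT.invRadius_le_iff hx (inv_pos.2 hr), inv_inv,
      ← toEuclideanLin_smul_eq_ray]
    exact sub_nonpos.symm
  exact IsGreatest.csSup_eq
    ⟨⟨inv_pos.2 hpos, (hmem (inv_pos.2 hpos)).2 le_rfl⟩, fun r hr => (hmem hr.1).1 hr.2⟩

theorem IsUniformSlater.differentiableAt_excess_of_existsUnique_subgradient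
    [InnerProductSpace ℝ H] [FiniteDimensional ℝ H]
    (hT : IsUniformSlater (excess T h L) x₀ δ) (hL : L.det ≠ 0)
    (hconv : ConvexOn ℝ univ T) (hh : DifferentiableAt ℝ h x) (hx : x ∈ Metric.ball x₀ δ)
    (hpos : 0 < invRadius (excess T h L) x v)
    (huniq : ∃! s, s ∈ subdiff T (pt x (ray L (rho T h L x v) v))) :
    DifferentiableAt ℝ (excess T h L) (x, (invRadius (excess T h L) x v)⁻¹ • v) := by
  obtain ⟨s, hs⟩ := singleton_iff_unique_mem.2 huniq
  rw [hT.rho_eq_inv_invRadius hx hpos, ← toEuclideanLin_smul_eq_ray] at hs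
  exact (hasFDerivAt_excess hL
    (hasFDerivAt_of_subdiff_eq_singleton hconv hs).differentiableAt hh).differentiableAt

end Boundary

section Probability

variable {Ω : Type*} [MeasurableSpace Ω] {P : Measure Ω}

theorem measureReal_preimage_eq_setIntegral {Z : Type*} [MeasurableSpace Z] {μ : Measure Z}
    {ξ : Ω → Z} {f : Z → ℝ} (hξ : AEMeasurable ξ P) (hf : Integrable f μ) (hf0 : ∀ z, 0 ≤ f z)
    (hdens : P.map ξ = μ.withDensity fun z => ENNReal.ofReal (f z)) {A : Set Z}
    (hA : MeasurableSet A) : P.real (ξ ⁻¹' A) = ∫ z in A, f z ∂μ := by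
  rw [Measure.real, ← Measure.map_apply_of_aemeasurable hξ hA, hdens, withDensity_apply _ hA,
    ← ofReal_integral_eq_lintegral_ofReal hf.integrableOn (.of_forall hf0),
    ENNReal.toReal_ofReal (integral_nonneg hf0)]

variable {H : Type*} [NormedAddCommGroup H] {m : ℕ} {ξ : Ω → Rm m}
  {f : Rm m → ℝ} {L : Matrix (Fin m) (Fin m) ℝ} {T : WithLp 2 (H × Rm m) → ℝ} {h : H → ℝ}

theorem measureReal_eq_feasibleMass (hξ : AEMeasurable ξ P) (hf : Integrable f)
    (hf0 : ∀ z, 0 ≤ f z)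
    (hdens : P.map ξ = (volume : Measure (Rm m)).withDensity fun z => ENNReal.ofReal (f z))
    (hL : L.det ≠ 0) (hT : Continuous T) (x : H) :
    P.real {ω | T (pt x (ξ ω)) ≤ h x} =
      feasibleMass volume (pullbackDensity L f) (excess T h L) x := by
  have hA : MeasurableSet {z | T (pt x z) ≤ h x} :=
    (isClosed_le (hT.comp ((WithLp.prod_continuous_toLp 2 H (Rm m)).comp (.prodMk_right x)))
      continuous_const).measurableSet
  have hpre : {z | excess T h L (x, z) ≤ 0} = matrixEquiv hL ⁻¹' {z | T (pt x z) ≤ h x} :=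
    ext fun z => sub_nonpos (a := T (pt x (matrixEquiv hL z)))
  rw [feasibleMass, hpre, ← integral_indicator ((matrixEquiv hL).continuous.measurable hA)]
  calc P.real {ω | T (pt x (ξ ω)) ≤ h x}
      = ∫ z, indicator {z | T (pt x z) ≤ h x} f z := by
        rw [integral_indicator hA]
        exact measureReal_preimage_eq_setIntegral hξ hf hf0 hdens hA
    _ = ∫ z, |L.det| • indicator {z | T (pt x z) ≤ h x} f (matrixEquiv hL z) := by
        rw [integral_eq_integral_abs_det_smul_comp volume (matrixEquiv hL), det_matrixEquiv]
    _ = ∫ z, indicator (matrixEquiv hL ⁻¹' {z | T (pt x z) ≤ h x}) (pullbackDensity L f) z := by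
        refine integral_congr_ae (.of_forall fun z => ?_)
        exact (indicator_const_smul_apply _ _ _ _).symm

variable {Y : Type*} [NormedAddCommGroup Y] [NormedSpace ℝ Y] {C : Set (WeakDual ℝ Y)}
  {K : ProperCone ℝ Y} {Φ : H → Rm m → Y}

theorem prob_eq_measureReal_supFun_le (hC_ne : C.Nonempty) (hC : IsCompact C)
    (hgen : GeneratesPolar C K) (x : H) :
    prob P ξ Φ K x = P.real {ω | supFun C Φ h (pt x (ξ ω)) ≤ h x} := by
  simp only [prob, hgen.neg_mem_iff, supFun_le_self_iff hC_ne hC]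

end Probability

section FeasibleMassMoreau

variable {m : ℕ} {L : Matrix (Fin m) (Fin m) ℝ} {H : Type*} [NormedAddCommGroup H]
  [InnerProductSpace ℝ H] [FiniteDimensional ℝ H] {S : WithLp 2 (H × Rm m) → ℝ} {h : H → ℝ}
  {x₀ : H} {δ : ℝ} {g : Rm m → ℝ}

theorem differentiableAt_feasibleMass_moreau [Nontrivial (Rm m)] (hL : L.det ≠ 0)
    (hS : ConvexOn ℝ univ S) (hh : Differentiable ℝ h)
    (hδ : ∀ T, ConvexOn ℝ univ T → T ≤ S → IsUniformSlater (excess T h L) x₀ δ)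
    (hg : HasRadialDecay (Module.finrank ℝ (Rm m)) g) {lam : ℝ} (hlam : 0 < lam) {x : H}
    (hx : x ∈ Metric.ball x₀ δ) :
    DifferentiableAt ℝ (feasibleMass volume g (excess (moreau S lam) h L)) x := by
  obtain ⟨s, hs⟩ := subdiff_nonempty hS hS.locallyLipschitz.continuous 0
  have hmoreau := hδ _ (convexOn_moreau hS hlam) (moreau_le_self hs hlam)
  exact (hmoreau.hasFDerivAt_feasibleMass hx hg (.of_forall fun v _ =>
    differentiable_excess hL (differentiable_moreau hS hlam) hh _)).2.differentiableAt

theorem tendsto_fderiv_feasibleMass_moreau [Nontrivial (Rm m)] (hL : L.det ≠ 0)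
    (hS : ConvexOn ℝ univ S) (hh : ContDiff ℝ 1 h)
    (hδ : ∀ T, ConvexOn ℝ univ T → T ≤ S → IsUniformSlater (excess T h L) x₀ δ)
    (hg : HasRadialDecay (Module.finrank ℝ (Rm m)) g)
    (hd : ∀ᵐ v : Sph m ∂(volume : Measure (Rm m)).toSphere, 0 < invRadius (excess S h L) x₀ v →
      DifferentiableAt ℝ (excess S h L) (x₀, (invRadius (excess S h L) x₀ v)⁻¹ • v)) :
    Tendsto (fun q : ℝ × H => fderiv ℝ (feasibleMass volume g (excess (moreau S q.1) h L)) q.2)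
      (𝓝[>] 0 ×ˢ 𝓝 x₀) (𝓝 (fderiv ℝ (feasibleMass volume g (excess S h L)) x₀)) := by
  obtain ⟨s, hs⟩ := subdiff_nonempty hS hS.locallyLipschitz.continuous 0
  have hpos : ∀ᶠ q in 𝓝[>] (0 : ℝ) ×ˢ 𝓝 x₀, 0 < q.1 :=
    tendsto_fst.eventually self_mem_nhdsWithin
  have hlam : Tendsto Prod.fst (𝓝[>] (0 : ℝ) ×ˢ 𝓝 x₀) (𝓝 0) :=
    tendsto_fst.mono_right nhdsWithin_le_nhds
  exact (hδ S hS le_rfl).tendsto_fderiv_feasibleMass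
    (hpos.mono fun q hq => hδ _ (convexOn_moreau hS hq) (moreau_le_self hs hq)) tendsto_snd hg
    (hpos.mono fun q hq =>
      differentiable_excess hL (differentiable_moreau hS hq) (hh.differentiable one_ne_zero))
    hd (fun _ _ => tendsto_excess_moreau hL hS hh.continuous hpos hlam)
    (fun _ _ => tendsto_fderiv_excess_moreau hL hS hh hpos hlam)

end FeasibleMassMoreau

theorem forall_seq_eventually_and_eq_of_mapClusterPt {X Z : Type*} [TopologicalSpace X]
    [TopologicalSpace Z] [T2Space Z] {x₀ : X} {D : ℝ → X → Prop} {F : ℝ → X → Z} {b : Z}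
    (hD : ∀ᶠ q in 𝓝[>] (0 : ℝ) ×ˢ 𝓝 x₀, D q.1 q.2)
    (hF : Tendsto (fun q => F q.1 q.2) (𝓝[>] (0 : ℝ) ×ˢ 𝓝 x₀) (𝓝 b)) (lam : ℕ → ℝ) (x : ℕ → X)
    (hpos : ∀ k, 0 < lam k) (hlam : Tendsto lam atTop (𝓝 0)) (hx : Tendsto x atTop (𝓝 x₀)) :
    (∀ᶠ k in atTop, D (lam k) (x k)) ∧
      ∀ g, MapClusterPt g atTop (fun k => F (lam k) (x k)) → g = b := by
  have hq : Tendsto (fun k => (lam k, x k)) atTop (𝓝[>] 0 ×ˢ 𝓝 x₀) :=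
    (tendsto_nhdsWithin_iff.2 ⟨hlam, .of_forall hpos⟩).prodMk hx
  exact ⟨hq.eventually hD, fun g hg => eq_of_nhds_neBot (hg.clusterPt.mono (hF.comp hq))⟩

theorem mainTheorem4_general
    {Ω : Type*} [MeasurableSpace Ω] {P : Measure Ω}
    {H : Type*} [NormedAddCommGroup H] [InnerProductSpace ℝ H] [FiniteDimensional ℝ H]
    {Y : Type*} [NormedAddCommGroup Y] [NormedSpace ℝ Y] {m : ℕ} (hm : 0 < m)
    {ξ : Ω → Rm m} (hξ : AEMeasurable ξ P)
    {f : Rm m → ℝ} (hf : HasRadialDecay m f) (hf0 : ∀ z, 0 ≤ f z)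
    (hdens : P.map ξ = (volume : Measure (Rm m)).withDensity fun z => ENNReal.ofReal (f z))
    {L : Matrix (Fin m) (Fin m) ℝ} (hL : L.det ≠ 0)
    {K : ProperCone ℝ Y} {C : Set (WeakDual ℝ Y)} (hC_ne : C.Nonempty) (hC : IsCompact C)
    (hgen : GeneratesPolar C K) {Φ : H → Rm m → Y} {h : H → ℝ} (hh : ContDiff ℝ 1 h)
    (hΦ : ∀ w ∈ C, ConvexOn ℝ univ (fun p : H × Rm m => w (Φ p.1 p.2) + h p.1))
    {x₀ : H} (hslater : supFun C Φ h (pt x₀ 0) < h x₀)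
    (hsingle : ∀ᵐ v ∂((volume : Measure (Rm m)).toSphere), v ∈ finDir (supFun C Φ h) h L x₀ →
      ∃! s, s ∈ subdiff (supFun C Φ h) (pt x₀ (ray L (rho (supFun C Φ h) h L x₀ v) v))) :
    (∃ κ : ℝ≥0, ∃ U ∈ 𝓝 x₀, LipschitzOnWith κ (prob P ξ Φ K) U) ∧
    DifferentiableAt ℝ (prob P ξ Φ K) x₀ ∧
    (∀ᶠ q in 𝓝[>] (0 : ℝ) ×ˢ 𝓝 x₀,
      DifferentiableAt ℝ (probReg P ξ (supFun C Φ h) h q.1) q.2) ∧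
    Tendsto (fun q => gradient (probReg P ξ (supFun C Φ h) h q.1) q.2) (𝓝[>] 0 ×ˢ 𝓝 x₀)
      (𝓝 (gradient (prob P ξ Φ K) x₀)) := by
  have : Nontrivial (Rm m) := Module.nontrivial_of_finrank_pos (R := ℝ) (by simpa)
  replace hf : HasRadialDecay (Module.finrank ℝ (Rm m)) f := by rwa [finrank_euclideanSpace_fin]
  have hg := hf.pullbackDensity hL
  have hS := convexOn_supFun hC_ne hC hΦ
  have hScont := hS.locallyLipschitz.continuous
  have hhd : Differentiable ℝ h := hh.differentiable one_ne_zero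
  obtain ⟨δ, hδ⟩ := exists_isUniformSlater_excess hL hScont.continuousAt hh.contDiffAt hslater
  have hslaterS := hδ _ hS le_rfl
  have hball : Metric.ball x₀ δ ∈ 𝓝 x₀ := Metric.ball_mem_nhds x₀ hslaterS.pos
  have hx₀ : x₀ ∈ Metric.ball x₀ δ := mem_of_mem_nhds hball
  have hprob : prob P ξ Φ K =
      feasibleMass volume (pullbackDensity L f) (excess (supFun C Φ h) h L) := funext fun x =>
    (prob_eq_measureReal_supFun_le hC_ne hC hgen x).trans
      (measureReal_eq_feasibleMass hξ hf.integrable hf0 hdens hL hScont x)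
  have hprobReg {lam : ℝ} (hlam : 0 < lam) : probReg P ξ (supFun C Φ h) h lam =
      feasibleMass volume (pullbackDensity L f) (excess (moreau (supFun C Φ h) lam) h L) :=
    funext <| measureReal_eq_feasibleMass hξ hf.integrable hf0 hdens hL
      (differentiable_moreau hS hlam).continuous
  have hdiff := hsingle.mono fun v hv hpos =>
    hslaterS.differentiableAt_excess_of_existsUnique_subgradient hL hS (hhd x₀) hx₀ hpos
      (hv (hslaterS.mem_finDir hx₀ hpos))
  have hpos : ∀ᶠ q in 𝓝[>] (0 : ℝ) ×ˢ 𝓝 x₀, 0 < q.1 :=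
    tendsto_fst.eventually self_mem_nhdsWithin
  rw [hprob]
  refine ⟨(hslaterS.exists_lipschitzOnWith_feasibleMass hg).imp fun κ hκ => ⟨_, hball, hκ⟩,
    (hslaterS.hasFDerivAt_feasibleMass hx₀ hg hdiff).2.differentiableAt, ?_, ?_⟩
  · filter_upwards [hpos, tendsto_snd.eventually hball] with q hlam hq
    rw [hprobReg hlam]
    exact differentiableAt_feasibleMass_moreau hL hS hhd hδ hg hlam hq
  · have hfderiv := tendsto_fderiv_feasibleMass_moreau hL hS hh hδ hg hdiff
    refine (((InnerProductSpace.toDual ℝ H).symm.continuous.tendsto _).comp hfderiv).congr' ?_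
    filter_upwards [hpos] with q hlam
    rw [hprobReg hlam, gradient, Function.comp_apply]

end ConicChance

theorem mainTheorem4
    {Ω : Type*} [MeasurableSpace Ω] (P : Measure Ω) [IsProbabilityMeasure P]
    {H : Type*} [NormedAddCommGroup H] [InnerProductSpace ℝ H] [FiniteDimensional ℝ H]
    {Y : Type*} [NormedAddCommGroup Y] [NormedSpace ℝ Y] [CompleteSpace Y]
    {m : ℕ} (hm : 0 < m)
    -- the random vector and its continuous density
    (ξ : Ω → ConicChance.Rm m) (hξ : Measurable ξ)
    (f : ConicChance.Rm m → ℝ) (hf_cont : Continuous f) (hf_nonneg : ∀ z, 0 ≤ f z)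
    (hf_dens : P.map ξ = (volume : Measure (ConicChance.Rm m)).withDensity
      (fun z => ENNReal.ofReal (f z)))
    (hf_tail : Tendsto (fun z => ‖z‖ ^ (m + 1) * f z)
      (Bornology.cobounded (ConicChance.Rm m)) (𝓝 0))
    -- the nonsingular matrix of the spherical radial decomposition
    (L : Matrix (Fin m) (Fin m) ℝ) (hL : L.det ≠ 0)
    -- the cone, the generating set of its polar, and the constraint mapping
    (K : ProperCone ℝ Y)
    (C : Set (WeakDual ℝ Y)) (hC_ne : C.Nonempty) (hC_comp : IsCompact C)
    (hC_conv : Convex ℝ C) (hC_gen : ConicChance.GeneratesPolar C K)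
    (Φ : H → ConicChance.Rm m → Y)
    (h : H → ℝ) (hh_smooth : ContDiff ℝ 1 h) (hh_conv : ConvexOn ℝ univ h)
    (hΦ : ∀ w ∈ C, ConvexOn ℝ univ
      (fun p : H × ConicChance.Rm m => w (Φ p.1 p.2) + h p.1))
    -- the reference point
    (x₀ : H)
    (h_slater : ConicChance.supFun C Φ h (ConicChance.pt x₀ 0) < h x₀)
    (h_growth : ∀ v₀ ∈ ConicChance.infDir (ConicChance.supFun C Φ h) h L x₀,
      ConicChance.EtaGrowth (ConicChance.supFun C Φ h) L f x₀ v₀)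
    (h_single : ∀ᵐ v ∂((volume : Measure (ConicChance.Rm m)).toSphere),
      v ∈ ConicChance.finDir (ConicChance.supFun C Φ h) h L x₀ →
        ∃! s, s ∈ ConicChance.subdiff (ConicChance.supFun C Φ h)
          (ConicChance.pt x₀ (ConicChance.ray L
            (ConicChance.rho (ConicChance.supFun C Φ h) h L x₀ v) v))) :
    (∃ κ : ℝ≥0, ∃ U ∈ 𝓝 x₀, LipschitzOnWith κ (ConicChance.prob P ξ Φ K) U) ∧
    DifferentiableAt ℝ (ConicChance.prob P ξ Φ K) x₀ ∧
    ∀ (lam : ℕ → ℝ) (x : ℕ → H), (∀ k, 0 < lam k) → Tendsto lam atTop (𝓝 0) →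
      Tendsto x atTop (𝓝 x₀) →
      (∀ᶠ k in atTop, DifferentiableAt ℝ
        (ConicChance.probReg P ξ (ConicChance.supFun C Φ h) h (lam k)) (x k)) ∧
      ∀ g : H, MapClusterPt g atTop
        (fun k => gradient
          (ConicChance.probReg P ξ (ConicChance.supFun C Φ h) h (lam k)) (x k)) →
        g = gradient (ConicChance.prob P ξ Φ K) x₀ := by
  obtain ⟨hlip, hdiff, hreg, hgrad⟩ := ConicChance.mainTheorem4_general hm hξ.aemeasurable
    ⟨hf_cont, hf_tail⟩ hf_nonneg hf_dens hL hC_ne hC_comp hC_gen hh_smooth hΦ h_slater h_single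
  exact ⟨hlip, hdiff, ConicChance.forall_seq_eventually_and_eq_of_mapClusterPt
    (D := fun lam => DifferentiableAt ℝ
      (ConicChance.probReg P ξ (ConicChance.supFun C Φ h) h lam))
    (F := fun lam => gradient (ConicChance.probReg P ξ (ConicChance.supFun C Φ h) h lam))
    hreg hgrad⟩
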